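/- **Setting.** Let $(T_i^*,C_i^*,\boldsymbol X_i)$, $i=1,2,\dots$, be event times, censoring times and covariate vectors in $\mathbb R^P$ ($T_i^*$ and $C_i^*$ may take the value $+\infty$, but not both at once), with observed data $\mathcal D_i=(T_i,\delta_i,\boldsymbol X_i)$, where $T_i=\min(T_i^*,C_i^*)\in\mathbb R$ and $\delta_i=\mathbf 1\{T_i^*\le C_i^*\}$. Assume that the $\mathcal D_i$ are independent and identically distributed, that $T_i^*$ and $C_i^*$ are conditionally independent given $\boldsymbol X_i$, and that, for some baseline hazard $h_0$ (nonnegative and locally integrable on $[0,\infty)$) and the true parameter $\boldsymbol\beta_0$, the Cox model holds: $T_i^*$ has conditional hazard $h(t\mid\boldsymbol X_i)=h_0(t)\exp(\boldsymbol X_i^\top\boldsymbol\beta_0)$ given $\boldsymbol X_i$, i.e. $P(T_i^*>t\mid\boldsymbol X_i)=\exp\{-\int_0^t h(s\mid \boldsymbol X_i)\,ds\}$ for $t\ge0$. Probability and expectation under this law are denoted $P_{\boldsymbol\beta_0}$ and $\mathbb E_{\boldsymbol\beta_0}$. For a sample of size $n$ let $R(t)=\{j\le n: T_j\ge t\}$,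 $p_{ij}(\boldsymbol\beta)=\dfrac{\exp\{(\boldsymbol X_i-\boldsymbol X_j)^\top\boldsymbol\beta\}}{1+\exp\{(\boldsymbol X_i-\boldsymbol X_j)^\top\boldsymbol\beta\}}$ and $$\mathcal L_{\mathrm{CPL}}(\boldsymbol\beta)=\prod_{i=1}^n\prod_{j\in R(T_i)\setminus\{i\}}p_{ij}(\boldsymbol\beta)^{\delta_i},\qquad \bar\ell_{n,\mathrm{CPL}}=\tbinom n2^{-1}\sum_{i=1}^n\sum_{j\in R(T_i)\setminus\{i\}}\delta_i\log p_{ij},$$ $$\ell_{n,\mathrm{PL}}(\boldsymbol\beta)=\sum_{i=1}^n\delta_i\Bigl(\boldsymbol X_i^\top\boldsymbol\beta-\log\sum_{j\in R(T_i)}\exp(\boldsymbol X_j^\top\boldsymbol\beta)\Bigr),\qquad \bar\ell_{n,\mathrm{PL}}=n^{-1}\ell_{n,\mathrm{PL}},\qquad S_{\mathrm{PL}}=\nabla\ell_{n,\mathrm{PL}}.$$ **Regularity conditions** (those on the sample of size $n$ are required for all sufficiently large $n$): - (C1) The parameter space $\mathcal B\subset\mathbb R^P$ is compact and $\boldsymbol\beta_0$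 lies in its interior. - (C2) $\mathbb E_{\boldsymbol\beta_0}[S_{\mathrm{PL}}(\boldsymbol\beta_0)]=\boldsymbol 0$, and $\mathbb E_{\boldsymbol\beta_0}[S_{\mathrm{PL}}(\boldsymbol\beta)]\ne\boldsymbol 0$ for every $\boldsymbol\beta\in\mathcal B$ with $\boldsymbol\beta\neq\boldsymbol\beta_0$. - (C3) $\bar\ell_{n,\mathrm{PL}}$ and $\bar\ell_{n,\mathrm{CPL}}$ are three times continuously differentiable at every point of $\mathcal B$. - (C4) For $k=1,2,3$, $\sup_{\boldsymbol\beta\in\mathcal B}\|\nabla^k\bar\ell_{n,\mathrm{PL}}(\boldsymbol\beta)\|=O_p(1)$ and $\sup_{\boldsymbol\beta\in\mathcal B}\|\nabla^k\bar\ell_{n,\mathrm{CPL}}(\boldsymbol\beta)\|=O_p(1)$. - (C5) The matrix $\boldsymbol J_n(\boldsymbol\beta)=-\mathbb E_{\boldsymbol\beta_0}[\nabla^2\bar\ell_{n,\mathrm{PL}}(\boldsymbol\beta)]$ is positive definite for every $\boldsymbol\beta\in\mathcal B$, and $\sup_{\boldsymbol\beta\in\mathcal B}\|\nabla^2\bar\ell_{n,\mathrm{PL}}(\boldsymbol\beta)+\boldsymbol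 J_n(\boldsymbol\beta)\|\to0$ in probability. - (C6) $\mathbb E_{\boldsymbol\beta_0}\|S_{\mathrm{PL}}(\boldsymbol\beta_0)\|^2<\infty$ and $\mathbb E_{\boldsymbol\beta_0}\|\varphi_1(\boldsymbol\beta_0)\|^2<\infty$, where $\varphi_i(\boldsymbol\beta)=\delta_i\sum_{j\in R(T_i)\setminus\{i\}}\{1-p_{ij}(\boldsymbol\beta)\}(\boldsymbol X_i-\boldsymbol X_j)$. **Proposition.** Under this model and (C1)–(C6), a maximizer of $\mathcal L_{\mathrm{CPL}}$ over $\mathcal B$ exists for every $n$ and every sample, and every maximum composite partial likelihood estimator, i.e. every sequence $\hat{\boldsymbol\beta}_{\mathrm{CPL}}=\hat{\boldsymbol\beta}_n$ with $\hat{\boldsymbol\beta}_n\in\arg\max_{\boldsymbol\beta\in\mathcal B}\mathcal L_{\mathrm{CPL}}(\boldsymbol\beta)$ almost surely for every $n$, converges in probability to the true value: $$\hat{\boldsymbol\beta}_{\mathrm{CPL}}\xrightarrow{P_{\boldsymbol\beta_0}}\boldsymbol\beta_0 .$$ -/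

import Mathlib

open MeasureTheory ProbabilityTheory Filter Topology
open scoped ENNReal Gradient

noncomputable section

namespace CoxCPL

/-- Covariate and parameter space `ℝ^P` with its Euclidean structure. -/
abbrev Vec (P : ℕ) : Type := EuclideanSpace ℝ (Fin P)

/-- The observation `(T, δ, X)` of one subject: observed time, event indicator (`0` or `1`),
covariate vector. -/
abbrev Obs (P : ℕ) : Type := ℝ × ℕ × Vec P

/-- Observed time `T`. -/
def Obs.time {P : ℕ} (d : Obs P) : ℝ := d.1

/-- Event indicator `δ`. -/
def Obs.event {P : ℕ} (d : Obs P) : ℕ := d.2.1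

/-- Covariate vector `X`. -/
def Obs.cov {P : ℕ} (d : Obs P) : Vec P := d.2.2

/-! ### The likelihoods of a sample

A sample is a sequence `D : ℕ → Obs P`; the sample of size `n` consists of the subjects
`0, …, n - 1`. -/

/-- Risk set `R(t)` of the sample of size `n`: the subjects with observed time at least `t`. -/
def riskSet {P : ℕ} (n : ℕ) (D : ℕ → Obs P) (t : ℝ) : Finset ℕ :=
  (Finset.range n).filter (fun j => t ≤ Obs.time (D j))

/-- `p_{ij}(β) = expit ((X_i - X_j)ᵀ β)`. -/
def pairProb {P : ℕ} (D : ℕ → Obs P) (i j : ℕ) (β : Vec P) : ℝ :=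
  Real.exp (inner ℝ (Obs.cov (D i) - Obs.cov (D j)) β) /
    (1 + Real.exp (inner ℝ (Obs.cov (D i) - Obs.cov (D j)) β))

/-- Composite partial likelihood
`∏_{i} ∏_{j ∈ R(T_i) \ {i}} p_{ij}(β)^{δ_i}`. -/
def compositePartialLik {P : ℕ} (n : ℕ) (D : ℕ → Obs P) (β : Vec P) : ℝ :=
  ∏ i ∈ Finset.range n, ∏ j ∈ (riskSet n D (Obs.time (D i))).erase i,
    pairProb D i j β ^ Obs.event (D i)

/-- Log composite partial likelihood `∑_{i} ∑_{j ∈ R(T_i) \ {i}} δ_i log p_{ij}(β)`. -/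
def logCPL {P : ℕ} (n : ℕ) (D : ℕ → Obs P) (β : Vec P) : ℝ :=
  ∑ i ∈ Finset.range n, ∑ j ∈ (riskSet n D (Obs.time (D i))).erase i,
    (Obs.event (D i) : ℝ) * Real.log (pairProb D i j β)

/-- Log composite partial likelihood divided by the number `n.choose 2` of pairs. -/
def normLogCPL {P : ℕ} (n : ℕ) (D : ℕ → Obs P) (β : Vec P) : ℝ :=
  ((n.choose 2 : ℕ) : ℝ)⁻¹ * logCPL n D β

/-- Log partial likelihood `∑_{i} δ_i (X_iᵀ β - log ∑_{j ∈ R(T_i)} exp (X_jᵀ β))`. -/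
def logPL {P : ℕ} (n : ℕ) (D : ℕ → Obs P) (β : Vec P) : ℝ :=
  ∑ i ∈ Finset.range n, (Obs.event (D i) : ℝ) *
    (inner ℝ (Obs.cov (D i)) β -
      Real.log (∑ j ∈ riskSet n D (Obs.time (D i)), Real.exp (inner ℝ (Obs.cov (D j)) β)))

/-- Log partial likelihood divided by the sample size. -/
def normLogPL {P : ℕ} (n : ℕ) (D : ℕ → Obs P) (β : Vec P) : ℝ :=
  (n : ℝ)⁻¹ * logPL n D β

/-- Partial score `S_PL(β)`, the gradient of the log partial likelihood. -/
def scorePL {P : ℕ} (n : ℕ) (D : ℕ → Obs P) (β : Vec P) : Vec P :=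
  ∇ (logPL n D) β

/-- Contribution of subject `i` to the composite partial score,
`φ_i(β) = δ_i ∑_{j ∈ R(T_i) \ {i}} (1 - p_{ij}(β)) (X_i - X_j)`. -/
def scoreTermCPL {P : ℕ} (n : ℕ) (D : ℕ → Obs P) (i : ℕ) (β : Vec P) : Vec P :=
  (Obs.event (D i) : ℝ) • ∑ j ∈ (riskSet n D (Obs.time (D i))).erase i,
    (1 - pairProb D i j β) • (Obs.cov (D i) - Obs.cov (D j))

/-! ### The data-generating process -/

/-- Conditional independence of `f` and `g` given `X`, through conditional probabilities given
the σ-algebra generated by `X`. -/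
def CondIndepGiven {Ω α α' γ : Type*} [MeasurableSpace Ω] [MeasurableSpace α]
    [MeasurableSpace α'] [MeasurableSpace γ] (μ : Measure Ω)
    (f : Ω → α) (g : Ω → α') (X : Ω → γ) : Prop :=
  ∀ s : Set α, ∀ t : Set α', MeasurableSet s → MeasurableSet t →
    μ⟦f ⁻¹' s ∩ g ⁻¹' t | MeasurableSpace.comap X inferInstance⟧ =ᵐ[μ]
      fun ω => (μ⟦f ⁻¹' s | MeasurableSpace.comap X inferInstance⟧) ω *
        (μ⟦g ⁻¹' t | MeasurableSpace.comap X inferInstance⟧) ω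

/-- `h(t ∣ x)` is the hazard function of the event time `S` given the covariate `X`: it is
nonnegative, locally integrable on `[0, ∞)`, and
`P(S > t ∣ X) = exp (-∫₀ᵗ h(s ∣ X) ds)` for every `t ≥ 0`. -/
structure HasCondHazard {Ω γ : Type*} [MeasurableSpace Ω] [MeasurableSpace γ] (μ : Measure Ω)
    (S : Ω → EReal) (X : Ω → γ) (h : ℝ → γ → ℝ) : Prop where
  nonneg : ∀ x : γ, ∀ t : ℝ, 0 < t → 0 ≤ h t x
  integrable : ∀ x : γ, ∀ t : ℝ, 0 ≤ t → IntervalIntegrable (fun s => h s x) volume 0 t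
  survival : ∀ t : ℝ, 0 ≤ t →
    μ⟦{ω | (t : EReal) < S ω} | MeasurableSpace.comap X inferInstance⟧ =ᵐ[μ]
      fun ω => Real.exp (-∫ s in (0 : ℝ)..t, h s (X ω))

/-- The data `D i = (T_i, δ_i, X_i)` are generated by the Cox proportional hazards model with
baseline hazard `h₀` and regression parameter `β₀`, from event times `Ts` and censoring times
`Cs` (either of which may be infinite, but not both at once). -/
structure CoxModel {Ω : Type*} [MeasurableSpace Ω] {P : ℕ} (μ : Measure Ω) (h₀ : ℝ → ℝ)
    (β₀ : Vec P) (Ts Cs : ℕ → Ω → EReal) (D : ℕ → Ω → Obs P) : Prop where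
  measurable_eventTime : ∀ i, Measurable (Ts i)
  measurable_censTime : ∀ i, Measurable (Cs i)
  measurable_obs : ∀ i, Measurable (D i)
  time_eq : ∀ i ω, (Obs.time (D i ω) : EReal) = min (Ts i ω) (Cs i ω)
  event_eq : ∀ i ω, Obs.event (D i ω) = if Ts i ω ≤ Cs i ω then 1 else 0
  indep : iIndepFun D μ
  identDistrib : ∀ i, IdentDistrib (D i) (D 0) μ μ
  nonInformative : ∀ i, CondIndepGiven μ (Ts i) (Cs i) (fun ω => Obs.cov (D i ω))
  hazard : ∀ i, HasCondHazard μ (Ts i) (fun ω => Obs.cov (D i ω))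
    (fun t x => h₀ t * Real.exp (inner ℝ x β₀))

/-! ### Stochastic order symbols for suprema over a parameter set -/

/-- `sup_{β ∈ B} F_n(β) = O_p(1)`. -/
def SupBoundedInProb {Ω E : Type*} [MeasurableSpace Ω] (μ : Measure Ω) (B : Set E)
    (F : ℕ → Ω → E → ℝ) : Prop :=
  ∀ ε : ℝ≥0∞, 0 < ε → ∃ M : ℝ, ∀ᶠ n in atTop, μ {ω | ∃ β ∈ B, M < F n ω β} ≤ ε

/-- `sup_{β ∈ B} F_n(β) → 0` in probability, for nonnegative `F_n`. -/
def SupTendstoZeroInProb {Ω E : Type*} [MeasurableSpace Ω] (μ : Measure Ω) (B : Set E)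
    (F : ℕ → Ω → E → ℝ) : Prop :=
  ∀ ε : ℝ, 0 < ε → Tendsto (fun n => μ {ω | ∃ β ∈ B, ε < F n ω β}) atTop (𝓝 0)

/-! ### Regularity conditions -/

/-- `J_n(β) = -E[∇² ℓ̄_{n,PL}(β)]`, as a bilinear form. -/
def infoPL {Ω : Type*} [MeasurableSpace Ω] {P : ℕ} (μ : Measure Ω) (D : ℕ → Ω → Obs P)
    (n : ℕ) (β : Vec P) : ContinuousMultilinearMap ℝ (fun _ : Fin 2 => Vec P) ℝ :=
  -∫ ω, iteratedFDeriv ℝ 2 (normLogPL n (fun i => D i ω)) β ∂μ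

/-- The regularity conditions on the parameter space `B`, the true value `β₀` and the law of the
data. Conditions on the sample of size `n` are required for all large `n`. -/
structure RegularityConditions {Ω : Type*} [MeasurableSpace Ω] {P : ℕ} (μ : Measure Ω)
    (B : Set (Vec P)) (β₀ : Vec P) (D : ℕ → Ω → Obs P) : Prop where
  /-- The parameter space is compact and `β₀` is an interior point. -/
  compact : IsCompact B
  interior : β₀ ∈ interior B
  /-- The expected partial score under the true law vanishes on `B` only at `β₀`. -/
  score_zero : ∀ᶠ n in atTop, ∫ ω, scorePL n (fun i => D i ω) β₀ ∂μ = 0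
  score_ne_zero : ∀ᶠ n in atTop, ∀ β ∈ B, β ≠ β₀ → ∫ ω, scorePL n (fun i => D i ω) β ∂μ ≠ 0
  /-- The normalized log-likelihoods are three times continuously differentiable on `B`. -/
  contDiff_PL : ∀ n, ∀ᵐ ω ∂μ, ∀ β ∈ B, ContDiffAt ℝ 3 (normLogPL n (fun i => D i ω)) β
  contDiff_CPL : ∀ n, ∀ᵐ ω ∂μ, ∀ β ∈ B, ContDiffAt ℝ 3 (normLogCPL n (fun i => D i ω)) β
  /-- The derivatives of orders one to three are bounded in probability, uniformly on `B`. -/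
  bounded_PL : ∀ k ∈ ({1, 2, 3} : Set ℕ), SupBoundedInProb μ B
    (fun n ω β => ‖iteratedFDeriv ℝ k (normLogPL n (fun i => D i ω)) β‖)
  bounded_CPL : ∀ k ∈ ({1, 2, 3} : Set ℕ), SupBoundedInProb μ B
    (fun n ω β => ‖iteratedFDeriv ℝ k (normLogCPL n (fun i => D i ω)) β‖)
  /-- The matrix `J_n(β)` is positive definite, and the Hessian of the normalized log partial
  likelihood is uniformly close to `-J_n(β)` in probability. -/
  info_posDef : ∀ᶠ n in atTop, ∀ β ∈ B, ∀ v : Vec P, v ≠ 0 → 0 < infoPL μ D n β ![v, v]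
  hessian_tendsto : SupTendstoZeroInProb μ B
    (fun n ω β => ‖iteratedFDeriv ℝ 2 (normLogPL n (fun i => D i ω)) β + infoPL μ D n β‖)
  /-- The partial score and the first composite score contribution are square integrable at
  `β₀`; subject `0` is the first subject. -/
  score_sq : ∀ᶠ n in atTop, Integrable (fun ω => ‖scorePL n (fun i => D i ω) β₀‖ ^ 2) μ
  scoreTerm_sq : ∀ᶠ n in atTop,
    Integrable (fun ω => ‖scoreTermCPL n (fun i => D i ω) 0 β₀‖ ^ 2) μ

/-- `b` maximizes the composite partial likelihood of the sample of size `n` over `B`. -/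
def IsMaxCPLEstimate {P : ℕ} (B : Set (Vec P)) (n : ℕ) (D : ℕ → Obs P) (b : Vec P) : Prop :=
  b ∈ B ∧ IsMaxOn (compositePartialLik n D) B b

end CoxCPL

end

/-! The composite likelihood is a product of two-subject likelihoods, so the proof is an
M-estimation argument for a U-statistic of order two. Under the Cox model the event indicator has a
compensator (`CoxModel.exists_compensator`). Hence a pair of subjects, restricted to "the first has
an event while the second is at risk", is distributed with a weight symmetric in the two subjects
times the relative risk of the first (`CoxModel.exists_symm_weight`). Symmetrizing this weight shows
that p(β)/p(β₀) integrates over `eventPairs` to the probability of that set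
(`CoxModel.lintegral_pairLik_div`).

The log-ratio itself need not be integrable, since no moments of the covariates are given. It is
dominated by 2(√(p(β)/p(β₀)) - 1), which is square integrable because the ratio is integrable. Its
mean is negative unless β - β₀ is orthogonal to X_i - X_j on almost all event pairs
(`CoxModel.integral_pairContrast_neg`). In that degenerate case the partial likelihood is invariant
under translation by β - β₀, so the expected partial score would vanish at β as well, against (C2)
(`RegularityConditions.not_ae_inner_eq_zero`).

Chebyshev's inequality for the U-statistic of contrasts makes the likelihood at each fixed β ≠ β₀
fall below its value at β₀. The first-derivative bound in (C4) and a finite cover make this uniform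
on a small sphere around β₀, and concavity of the log-likelihood then keeps every maximizer inside
that sphere. -/

namespace CoxCPL

/-! ### Laws on the extended reals with a given hazard -/

open Set in
/-- The distribution function of the survival function with hazard `h`. -/
lemma integral_mul_exp_neg_integral {h : ℝ → ℝ} {b : ℝ} (hb : 0 ≤ b)
    (hi : IntervalIntegrable h volume 0 b) (hn : ∀ t, 0 < t → 0 ≤ h t) :
    ∫ t in (0 : ℝ)..b, h t * Real.exp (-∫ s in (0 : ℝ)..t, h s) =
      1 - Real.exp (-∫ s in (0 : ℝ)..b, h s) := by
  have hac := hi.absolutelyContinuousOnInterval_intervalIntegral (c := 0) (by simp)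
  have hnn : ∀ x ∈ uIcc 0 b, 0 ≤ ∫ s in (0 : ℝ)..x, h s := by
    intro x hx
    rw [uIcc_of_le hb] at hx
    rw [intervalIntegral.integral_of_le hx.1]
    exact setIntegral_nonneg measurableSet_Ioc fun t ht => hn t ht.1
  -- The hazard is merely integrable, so the fundamental theorem is applied to an absolutely
  -- continuous function. Composition with `exp (-·)` preserves absolute continuity because that map
  -- is 1-Lipschitz on `[0, ∞)`, where the cumulative hazard takes its values.
  have hexp : AbsolutelyContinuousOnInterval
      (fun x => Real.exp (-∫ s in (0 : ℝ)..x, h s)) 0 b := by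
    have hlip : ∀ u v : ℝ, 0 ≤ u → 0 ≤ v →
        dist (Real.exp (-u)) (Real.exp (-v)) ≤ dist u v := by
      have key : ∀ u v : ℝ, 0 ≤ u → u ≤ v → Real.exp (-u) - Real.exp (-v) ≤ v - u := by
        intro u v hu huv
        have h1 : Real.exp (-v) = Real.exp (-u) * Real.exp (-(v - u)) := by
          rw [← Real.exp_add]; ring_nf
        have h2 := Real.add_one_le_exp (-(v - u))
        have h3 : Real.exp (-u) ≤ 1 := Real.exp_le_one_iff.2 (by linarith)
        have h4 := Real.exp_pos (-u)
        rw [h1]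
        nlinarith
      intro u v hu hv
      rw [Real.dist_eq, Real.dist_eq]
      rcases le_total u v with huv | huv
      · have := Real.exp_le_exp.2 (neg_le_neg huv)
        rw [abs_of_nonneg (by linarith), abs_of_nonpos (by linarith)]
        linarith [key u v hu huv]
      · have := Real.exp_le_exp.2 (neg_le_neg huv)
        rw [abs_of_nonpos (by linarith), abs_of_nonneg (by linarith)]
        linarith [key v u hv huv]
    rw [absolutelyContinuousOnInterval_iff] at hac ⊢
    intro ε hε
    obtain ⟨δ, hδ, H⟩ := hac ε hε
    refine ⟨δ, hδ, fun E hE hl => lt_of_le_of_lt (Finset.sum_le_sum fun i hi' => ?_) (H E hE hl)⟩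
    exact hlip _ _ (hnn _ (hE.1 i hi').1) (hnn _ (hE.1 i hi').2)
  have hftc := hexp.integral_deriv_eq_sub
  simp only [intervalIntegral.integral_same, neg_zero, Real.exp_zero] at hftc
  have hcongr : ∫ t in (0 : ℝ)..b, h t * Real.exp (-∫ s in (0 : ℝ)..t, h s) =
      ∫ t in (0 : ℝ)..b, -deriv (fun x => Real.exp (-∫ s in (0 : ℝ)..x, h s)) t := by
    refine intervalIntegral.integral_congr_ae ?_
    filter_upwards [hi.ae_hasDerivAt_integral] with x hx hxm
    have hd := ((hx (uIoc_subset_uIcc hxm) 0 (by simp)).neg).exp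
    have hd' : HasDerivAt (fun x => Real.exp (-∫ s in (0 : ℝ)..x, h s))
        (Real.exp (-∫ s in (0 : ℝ)..x, h s) * -h x) x := hd
    rw [hd'.deriv]
    ring
  rw [hcongr, intervalIntegral.integral_neg, hftc]
  ring

open Set in
lemma aemeasurable_Ioi_of_intervalIntegrable {h : ℝ → ℝ}
    (hi : ∀ t, 0 ≤ t → IntervalIntegrable h volume 0 t) :
    AEMeasurable h (volume.restrict (Ioi (0 : ℝ))) := by
  have h1 : AEMeasurable h (volume.restrict (⋃ n : ℕ, Ioc (0 : ℝ) n)) :=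
    aemeasurable_iUnion_iff.2 fun n =>
      ((intervalIntegrable_iff_integrableOn_Ioc_of_le (Nat.cast_nonneg n)).1
        (hi n (Nat.cast_nonneg n))).aestronglyMeasurable.aemeasurable
  refine h1.mono_set fun x hx => mem_iUnion.2 ?_
  obtain ⟨n, hn⟩ := exists_nat_ge x
  exact ⟨n, hx, hn⟩

open Set in
lemma continuousOn_integral_of_intervalIntegrable {h : ℝ → ℝ}
    (hi : ∀ t, 0 ≤ t → IntervalIntegrable h volume 0 t) :
    ContinuousOn (fun t : ℝ => ∫ s in (0 : ℝ)..t, h s) (Ici 0) := by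
  intro x hx
  have h1 : ContinuousOn (fun t : ℝ => ∫ s in (0 : ℝ)..t, h s) (uIcc 0 (x + 1)) :=
    ((hi (x + 1) (by linarith [mem_Ici.1 hx])
      ).absolutelyContinuousOnInterval_intervalIntegral (c := 0) (by simp)).continuousOn
  rw [uIcc_of_le (by linarith [mem_Ici.1 hx])] at h1
  refine (h1 x ⟨hx, by linarith⟩).mono_of_mem_nhdsWithin ?_
  filter_upwards [self_mem_nhdsWithin, mem_nhdsWithin_of_mem_nhds (Iio_mem_nhds (lt_add_one x))]
    with y hy hy'
  exact ⟨hy, le_of_lt hy'⟩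

open Set in
/-- A law on the extended reals with hazard `h` on `(0, ∞)` satisfies
`E[f(S); S finite] = ∫₀^∞ f(t) P(S ≥ t) h(t) dt`. -/
lemma lintegral_eq_lintegral_hazard {κ : Measure EReal} [IsProbabilityMeasure κ] {h : ℝ → ℝ}
    (hi : ∀ t, 0 ≤ t → IntervalIntegrable h volume 0 t) (hn : ∀ t, 0 < t → 0 ≤ h t)
    (hκ : ∀ t : ℝ, 0 ≤ t → κ (Ioi (t : EReal)) =
      ENNReal.ofReal (Real.exp (-∫ s in (0 : ℝ)..t, h s)))
    {f : EReal → ℝ≥0∞} (hf : Measurable f) (hf_top : f ⊤ = 0) (hf_bot : f ⊥ = 0) :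
    ∫⁻ s, f s ∂κ = ∫⁻ t in Ioi (0 : ℝ), f t * κ (Ici (t : EReal)) * ENNReal.ofReal (h t) := by
  have hemb : MeasurableEmbedding ((↑) : ℝ → EReal) := EReal.measurableEmbedding_coe
  set m : Measure ℝ := κ.comap ((↑) : ℝ → EReal) with hm
  set d : ℝ → ℝ≥0∞ := fun t =>
    ENNReal.ofReal (h t * Real.exp (-∫ s in (0 : ℝ)..t, h s)) with hd
  have hmapp : ∀ s, m s = κ (((↑) : ℝ → EReal) '' s) := fun s => hemb.comap_apply κ s
  have : IsFiniteMeasure m := ⟨by rw [hmapp]; exact measure_lt_top _ _⟩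
  -- The survival formula at `t = 0` puts all the mass on `(0, ∞]`.
  have hbot : κ {x : EReal | x ≤ 0} = 0 := by
    have h1 : κ (Ioi (0 : EReal)) = 1 := by simpa using hκ 0 le_rfl
    have h2 := (prob_compl_eq_zero_iff (μ := κ) (measurableSet_Ioi (a := (0 : EReal)))).2 h1
    rwa [compl_Ioi] at h2
  have hcont := continuousOn_integral_of_intervalIntegrable hi
  have hint : ∀ b, 0 ≤ b → IntervalIntegrable
      (fun t => h t * Real.exp (-∫ s in (0 : ℝ)..t, h s)) volume 0 b := by
    intro b hb
    refine (hi b hb).mul_continuousOn (Real.continuous_exp.comp_continuousOn (hcont.neg.mono ?_))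
    rw [uIcc_of_le hb]
    exact fun x hx => hx.1
  -- The finite part of the law has density hazard times survival: both measures have the same
  -- distribution function.
  have hmd : m = (volume.restrict (Ioi (0 : ℝ))).withDensity d := by
    refine Measure.ext_of_Iic _ _ fun b => ?_
    rw [withDensity_apply _ measurableSet_Iic, Measure.restrict_restrict measurableSet_Iic,
      inter_comm, Ioi_inter_Iic]
    rcases le_total b 0 with hb | hb
    · rw [Ioc_eq_empty (by simpa using hb), hmapp]
      simp only [Measure.restrict_empty, lintegral_zero_measure]
      refine measure_mono_null ?_ hbot
      rintro _ ⟨x, hx, rfl⟩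
      exact show (x : EReal) ≤ 0 by exact_mod_cast (mem_Iic.1 hx).trans hb
    · have h1 : ∫⁻ t in Ioc 0 b, d t = ENNReal.ofReal
          (1 - Real.exp (-∫ s in (0 : ℝ)..b, h s)) := by
        rw [← integral_mul_exp_neg_integral hb (hi b hb) hn, intervalIntegral.integral_of_le hb,
          ofReal_integral_eq_lintegral_ofReal]
        · exact (intervalIntegrable_iff_integrableOn_Ioc_of_le hb).1 (hint b hb)
        · filter_upwards [ae_restrict_mem measurableSet_Ioc] with t ht
          exact mul_nonneg (hn t ht.1) (Real.exp_pos _).le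
      rw [h1, hmapp]
      have h2 : κ (((↑) : ℝ → EReal) '' Iic b) = κ (Iic (b : EReal)) := by
        refine measure_congr ?_
        have h0 : ∀ᵐ x ∂κ, ¬ x ≤ 0 := by rw [ae_iff]; simpa using hbot
        filter_upwards [h0] with x hx
        refine propext ⟨?_, fun hxb => ?_⟩
        · rintro ⟨y, hy, rfl⟩
          exact EReal.coe_le_coe_iff.2 hy
        · induction x with
          | bot => simp at hx
          | top => exact absurd (show (⊤ : EReal) ≤ b from hxb) (by simp)
          | coe x => exact ⟨x, EReal.coe_le_coe_iff.1 hxb, rfl⟩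
      rw [h2, ← compl_Ioi, prob_compl_eq_one_sub measurableSet_Ioi, hκ b hb,
        ENNReal.ofReal_sub _ (Real.exp_pos _).le, ENNReal.ofReal_one]
  have hdm : AEMeasurable d (volume.restrict (Ioi (0 : ℝ))) :=
    (aemeasurable_Ioi_of_intervalIntegrable hint).ennreal_ofReal
  have hrange : ∫⁻ s, f s ∂κ = ∫⁻ t : ℝ, f t ∂m := by
    rw [← hemb.lintegral_map, hm, hemb.map_comap, ← lintegral_indicator hemb.measurableSet_range]
    refine lintegral_congr fun s => ?_
    induction s with
    | bot => simp [hf_bot, indicator]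
    | top => simp [hf_top, indicator]
    | coe s => simp
  -- Having a density, the law has no atoms on the real line, so `S ≥ t` and `S > t` are equally
  -- likely.
  have hIci : ∀ t : ℝ, 0 < t → κ (Ici (t : EReal)) =
      ENNReal.ofReal (Real.exp (-∫ s in (0 : ℝ)..t, h s)) := by
    intro t ht
    have h1 : κ {(t : EReal)} = 0 := by
      have h2 : m {t} = 0 := by
        rw [hmd]
        exact (withDensity_absolutelyContinuous _ _) (by simp)
      rwa [hmapp, image_singleton] at h2
    rw [← hκ t ht.le]
    exact (measure_congr (Ioi_ae_eq_Ici' h1)).symm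
  rw [hrange, hmd, lintegral_withDensity_eq_lintegral_mul₀ (g := fun t : ℝ => f t) hdm
    (hf.comp measurable_coe_real_ereal).aemeasurable]
  refine setLIntegral_congr_fun measurableSet_Ioi fun t ht => ?_
  simp only [Pi.mul_apply, hd, hIci t ht]
  rw [ENNReal.ofReal_mul (hn t ht)]
  ring

/-! ### Conditional laws given the covariate -/

section ConditionalLaw

variable {Ω : Type*} [MeasurableSpace Ω] {μ : Measure Ω} [IsProbabilityMeasure μ]

/-- The joint law of `X` and of two variables that are conditionally independent given `X`. -/
lemma CondIndepGiven.map_eq_compProd {α α' γ : Type*} [MeasurableSpace α] [StandardBorelSpace α]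
    [Nonempty α] [MeasurableSpace α'] [StandardBorelSpace α'] [Nonempty α'] [MeasurableSpace γ]
    {f : Ω → α} {g : Ω → α'} {X : Ω → γ} (h : CondIndepGiven μ f g X) (hf : Measurable f)
    (hg : Measurable g) (hX : Measurable X) :
    μ.map (fun ω => (X ω, f ω, g ω)) =
      μ.map X ⊗ₘ (condDistrib f X μ ×ₖ condDistrib g X μ) := by
  have : IsProbabilityMeasure (μ.map X) := Measure.isProbabilityMeasure_map hX.aemeasurable
  refine Measure.ext_prod₃ fun {A s t} hA hs ht => ?_
  rw [Measure.compProd_apply_prod hA (hs.prod ht)]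
  simp_rw [Kernel.prod_apply_prod]
  rw [setLIntegral_map (f := fun a => condDistrib f X μ a s * condDistrib g X μ a t) hA
      ((Kernel.measurable_coe _ hs).mul (Kernel.measurable_coe _ ht)) hX,
    Measure.map_apply (hX.prodMk (hf.prodMk hg)) (hA.prod (hs.prod ht))]
  have hae : (fun ω => (condDistrib f X μ (X ω)).real s * (condDistrib g X μ (X ω)).real t) =ᵐ[μ]
      μ⟦f ⁻¹' s ∩ g ⁻¹' t | MeasurableSpace.comap X inferInstance⟧ := by
    filter_upwards [h s t hs ht, condDistrib_ae_eq_condExp (μ := μ) hX hf hs,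
      condDistrib_ae_eq_condExp (μ := μ) hX hg ht] with ω h1 h2 h3
    rw [h1, ← h2, ← h3]
  have hst : MeasurableSet (f ⁻¹' s ∩ g ⁻¹' t) := (hf hs).inter (hg ht)
  have hset : ∫ ω in X ⁻¹' A,
      (condDistrib f X μ (X ω)).real s * (condDistrib g X μ (X ω)).real t ∂μ =
      (μ (X ⁻¹' A ∩ (f ⁻¹' s ∩ g ⁻¹' t))).toReal := by
    rw [setIntegral_congr_ae (g := μ⟦f ⁻¹' s ∩ g ⁻¹' t | MeasurableSpace.comap X inferInstance⟧)
      (hX hA) (hae.mono fun ω hω _ => hω),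
      setIntegral_condExp hX.comap_le ((integrable_const _).indicator hst) ⟨A, hA, rfl⟩,
      integral_indicator_const _ hst, measureReal_restrict_apply hst, smul_eq_mul, mul_one,
      Set.inter_comm, measureReal_def]
  have hint : Integrable (fun ω => (condDistrib f X μ (X ω)).real s *
      (condDistrib g X μ (X ω)).real t) (μ.restrict (X ⁻¹' A)) :=
    (integrable_condExp.congr hae.symm).integrableOn
  have h1 := ofReal_integral_eq_lintegral_ofReal hint
    (Eventually.of_forall fun ω => mul_nonneg measureReal_nonneg measureReal_nonneg)
  rw [hset, ENNReal.ofReal_toReal (measure_ne_top _ _)] at h1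
  refine Eq.trans (congrArg μ ?_) (h1.trans (lintegral_congr fun ω => ?_))
  · ext ω; simp
  · rw [ENNReal.ofReal_mul measureReal_nonneg, ofReal_measureReal, ofReal_measureReal]

/-- Squeezing between rationals on either side of `t` suffices: monotonicity of one function
replaces its continuity. This is what merges the exceptional null sets of the separate time points
into one. -/
lemma eqOn_of_antitone_of_eq_rat {φ ψ : ℝ → ℝ≥0∞} (hφ : Antitone φ)
    (hψ : ContinuousOn ψ (Set.Ici 0)) (h : ∀ q : ℚ, 0 ≤ q → φ q = ψ q) {t : ℝ} (ht : 0 ≤ t) :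
    φ t = ψ t := by
  refine le_antisymm (not_lt.1 fun hlt => ?_) (not_lt.1 fun hlt => ?_)
  · rcases ht.eq_or_lt with rfl | ht'
    · have := h 0 le_rfl
      simp only [Rat.cast_zero] at this
      exact hlt.ne' this
    · have h1 : ∀ᶠ x in 𝓝 t, ψ x < φ t :=
        (hψ.continuousAt (Ici_mem_nhds ht')).eventually_lt continuousAt_const hlt
      obtain ⟨l, hl, hl'⟩ := exists_Ioc_subset_of_mem_nhds h1 ⟨0, ht'⟩
      obtain ⟨q, hq, hq'⟩ := exists_rat_btwn (max_lt hl ht')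
      have h2 : ψ q < φ t := hl' ⟨(le_max_left _ _).trans_lt hq, hq'.le⟩
      have h3 : (0 : ℝ) ≤ q := (le_max_right _ _).trans hq.le
      rw [← h q (by exact_mod_cast h3)] at h2
      exact absurd (hφ hq'.le) (not_le.2 h2)
  · have h1 : ∀ᶠ x in 𝓝[≥] t, φ t < ψ x :=
      continuousWithinAt_const.eventually_lt ((hψ t ht).mono (Set.Ici_subset_Ici.2 ht)) hlt
    obtain ⟨u, hu, hu'⟩ := mem_nhdsGE_iff_exists_Ico_subset.1 h1
    obtain ⟨q, hq, hq'⟩ := exists_rat_btwn (Set.mem_Ioi.1 hu)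
    have h2 : φ t < ψ q := hu' ⟨hq.le, hq'⟩
    rw [← h q (by exact_mod_cast ht.trans hq.le)] at h2
    exact absurd (hφ hq.le) (not_le.2 h2)

/-- The model gives the survival formula almost surely for each `t` separately. Working with a
regular conditional distribution and rational times yields one null set valid for all `t`, so that
the conditional law can be treated as a measure with a hazard. -/
lemma HasCondHazard.condDistrib_Ioi {γ : Type*} [MeasurableSpace γ] {S : Ω → EReal} {X : Ω → γ}
    {h : ℝ → γ → ℝ} (hh : HasCondHazard μ S X h) (hS : Measurable S) (hX : Measurable X) :
    ∀ᵐ ω ∂μ, ∀ t : ℝ, 0 ≤ t → condDistrib S X μ (X ω) (Set.Ioi (t : EReal)) =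
      ENNReal.ofReal (Real.exp (-∫ s in (0 : ℝ)..t, h s (X ω))) := by
  have hq : ∀ᵐ ω ∂μ, ∀ q : ℚ, 0 ≤ q →
      condDistrib S X μ (X ω) (Set.Ioi (((q : ℝ)) : EReal)) =
        ENNReal.ofReal (Real.exp (-∫ s in (0 : ℝ)..(q : ℝ), h s (X ω))) := by
    refine ae_all_iff.2 fun q => ?_
    by_cases hq : 0 ≤ q
    · filter_upwards [hh.survival q (by exact_mod_cast hq),
        condDistrib_ae_eq_condExp (μ := μ) hX hS (measurableSet_Ioi (a := ((q : ℝ) : EReal)))]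
        with ω h1 h2 _
      rw [← h1, ← ofReal_measureReal]
      exact congrArg _ h2
    · exact Eventually.of_forall fun ω h => absurd h hq
  filter_upwards [hq] with ω hω t ht
  refine eqOn_of_antitone_of_eq_rat
    (φ := fun t : ℝ => condDistrib S X μ (X ω) (Set.Ioi (t : EReal)))
    (ψ := fun t : ℝ => ENNReal.ofReal (Real.exp (-∫ s in (0 : ℝ)..t, h s (X ω))))
    (fun a b hab => measure_mono (Set.Ioi_subset_Ioi (EReal.coe_le_coe_iff.2 hab))) ?_ hω ht
  exact ENNReal.continuous_ofReal.comp_continuousOn (Real.continuous_exp.comp_continuousOn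
    (continuousOn_integral_of_intervalIntegrable (hh.integrable (X ω))).neg)

lemma lintegral_prod_condDistrib {α α' γ : Type*} [MeasurableSpace α] [StandardBorelSpace α]
    [Nonempty α] [MeasurableSpace α'] [StandardBorelSpace α'] [Nonempty α'] [MeasurableSpace γ]
    {f : Ω → α} {g : Ω → α'} {X : Ω → γ} (h : CondIndepGiven μ f g X) (hf : Measurable f)
    (hg : Measurable g) (hX : Measurable X) {F : γ × α × α' → ℝ≥0∞} (hF : Measurable F) :
    ∫⁻ ω, F (X ω, f ω, g ω) ∂μ =
      ∫⁻ ω, ∫⁻ c, ∫⁻ s, F (X ω, s, c) ∂(condDistrib f X μ (X ω)) ∂(condDistrib g X μ (X ω)) ∂μ := by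
  have : IsProbabilityMeasure (μ.map X) := Measure.isProbabilityMeasure_map hX.aemeasurable
  rw [← lintegral_map hF (hX.prodMk (hf.prodMk hg)), h.map_eq_compProd hf hg hX,
    Measure.lintegral_compProd hF, lintegral_map hF.lintegral_kernel_prod_right' hX]
  refine lintegral_congr fun ω => ?_
  have hF' : Measurable fun z : α × α' => F (X ω, z) := hF.comp measurable_prodMk_left
  rw [Kernel.lintegral_prod _ _ _ hF', lintegral_lintegral_swap hF'.aemeasurable]

end ConditionalLaw

/-! ### The compensator of the event indicator -/

/-- The compensator of the event indicator: there is a measure `lam` (the cumulative baseline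
hazard) with `E[δ G(T, X)] = E[∫_{t ≤ T} exp(Xᵀβ₀) G(t, X) dlam(t)]`. -/
theorem CoxModel.exists_compensator {Ω : Type*} [MeasurableSpace Ω] {P : ℕ} {μ : Measure Ω}
    [IsProbabilityMeasure μ] {h₀ : ℝ → ℝ} {β₀ : Vec P} {Ts Cs : ℕ → Ω → EReal}
    {D : ℕ → Ω → Obs P} (hM : CoxModel μ h₀ β₀ Ts Cs D) (i : ℕ) :
    ∃ lam : Measure ℝ, SFinite lam ∧ ∀ G : ℝ × Vec P → ℝ≥0∞, Measurable G →
      ∫⁻ ω, (Obs.event (D i ω) : ℝ≥0∞) * G (Obs.time (D i ω), Obs.cov (D i ω)) ∂μ =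
      ∫⁻ ω, ∫⁻ t, (if t ≤ Obs.time (D i ω) then
        ENNReal.ofReal (Real.exp (inner ℝ (Obs.cov (D i ω)) β₀)) * G (t, Obs.cov (D i ω))
        else 0) ∂lam ∂μ := by
  have hhaz := hM.hazard i
  have hTs := hM.measurable_eventTime i
  have hCs := hM.measurable_censTime i
  set X : Ω → Vec P := fun ω => Obs.cov (D i ω) with hXdef
  have hX : Measurable X := measurable_snd.comp (measurable_snd.comp (hM.measurable_obs i))
  have hi₀ : ∀ t, 0 ≤ t → IntervalIntegrable h₀ volume 0 t := by
    intro t ht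
    simpa using hhaz.integrable 0 t ht
  have hmeas := (aemeasurable_Ioi_of_intervalIntegrable hi₀).ennreal_ofReal
  -- Local integrability makes `h₀` only almost everywhere measurable on `(0, ∞)`; a measurable
  -- version serves as the density of `lam`.
  set w := hmeas.mk _ with hw
  have hwm : Measurable w := hmeas.measurable_mk
  refine ⟨(volume.restrict (Set.Ioi (0 : ℝ))).withDensity w, inferInstance, fun G hG => ?_⟩
  set lam := (volume.restrict (Set.Ioi (0 : ℝ))).withDensity w with hlam
  have hexp : Measurable fun x : Vec P => ENNReal.ofReal (Real.exp (inner ℝ x β₀)) := by fun_prop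
  -- An event time not exceeding the censoring time is automatically finite here, as the minimum of
  -- the two is real. Excluding `⊤` and `⊥` therefore changes nothing and meets the vanishing
  -- conditions of `lintegral_eq_lintegral_hazard`.
  set F₁ : Vec P × EReal × EReal → ℝ≥0∞ := fun z =>
    if z.2.1 ≤ z.2.2 ∧ z.2.1 ≠ ⊤ ∧ z.2.1 ≠ ⊥ then G (z.2.1.toReal, z.1) else 0 with hF₁
  have hF₁m : Measurable F₁ := by
    refine Measurable.ite ?_ (by fun_prop) measurable_const
    refine (measurableSet_le (f := fun z : Vec P × EReal × EReal => z.2.1) (g := fun z => z.2.2)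
      (by fun_prop) (by fun_prop)).inter
      (MeasurableSet.inter (MeasurableSet.compl ?_) (MeasurableSet.compl ?_))
    · exact measurableSet_eq_fun (by fun_prop) measurable_const
    · exact measurableSet_eq_fun (by fun_prop) measurable_const
  set K : (Vec P × EReal × EReal) × ℝ → ℝ≥0∞ := fun z =>
    if (z.2 : EReal) ≤ z.1.2.1 ∧ (z.2 : EReal) ≤ z.1.2.2 then
      ENNReal.ofReal (Real.exp (inner ℝ z.1.1 β₀)) * G (z.2, z.1.1) else 0 with hK
  have hKm : Measurable K := by
    refine Measurable.ite ?_ (by fun_prop) measurable_const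
    have hcoe : Measurable fun z : (Vec P × EReal × EReal) × ℝ => (z.2 : EReal) :=
      measurable_coe_real_ereal.comp measurable_snd
    exact (measurableSet_le (g := fun z : (Vec P × EReal × EReal) × ℝ => z.1.2.1) hcoe
      (by fun_prop)).inter
      (measurableSet_le (g := fun z : (Vec P × EReal × EReal) × ℝ => z.1.2.2) hcoe (by fun_prop))
  have hL : ∫⁻ ω, (Obs.event (D i ω) : ℝ≥0∞) * G (Obs.time (D i ω), Obs.cov (D i ω)) ∂μ =
      ∫⁻ ω, F₁ (X ω, Ts i ω, Cs i ω) ∂μ := by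
    refine lintegral_congr fun ω => ?_
    have ht := hM.time_eq i ω
    simp only [hF₁, hM.event_eq i ω]
    by_cases hle : Ts i ω ≤ Cs i ω
    · rw [min_eq_left hle] at ht
      simp [← ht, hXdef]
    · simp [hle]
  have hR : ∫⁻ ω, ∫⁻ t, (if t ≤ Obs.time (D i ω) then
        ENNReal.ofReal (Real.exp (inner ℝ (Obs.cov (D i ω)) β₀)) * G (t, Obs.cov (D i ω))
        else 0) ∂lam ∂μ = ∫⁻ ω, ∫⁻ t, K ((X ω, Ts i ω, Cs i ω), t) ∂lam ∂μ := by
    refine lintegral_congr fun ω => lintegral_congr fun t => ?_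
    have h1 : t ≤ Obs.time (D i ω) ↔ (t : EReal) ≤ Ts i ω ∧ (t : EReal) ≤ Cs i ω := by
      rw [← le_min_iff, ← hM.time_eq i ω, EReal.coe_le_coe_iff]
    simp only [hK, h1, hXdef]
  rw [hL, hR, lintegral_prod_condDistrib (hM.nonInformative i) hTs hCs hX hF₁m,
    lintegral_prod_condDistrib (F := fun z => ∫⁻ t, K (z, t) ∂lam) (hM.nonInformative i) hTs hCs hX
      hKm.lintegral_prod_right']
  refine lintegral_congr_ae ?_
  filter_upwards [hhaz.condDistrib_Ioi hTs hX] with ω hω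
  refine lintegral_congr fun c => ?_
  set κ := condDistrib (Ts i) X μ (X ω)
  rw [lintegral_eq_lintegral_hazard (hhaz.integrable (X ω)) (hhaz.nonneg (X ω)) hω
    (f := fun s => F₁ (X ω, s, c)) (hF₁m.comp (by fun_prop)) (by simp [hF₁]) (by simp [hF₁])]
  have hKm' : Measurable fun z : EReal × ℝ => K ((X ω, z.1, c), z.2) := hKm.comp (by fun_prop)
  -- With covariate and censoring time `c` fixed, integrating out the event time first turns `t ≤ S`
  -- into the survival factor `κ (Ici t)`, matching the other side.
  rw [lintegral_lintegral_swap hKm'.aemeasurable, hlam,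
    lintegral_withDensity_eq_lintegral_mul _ hwm hKm'.lintegral_prod_left']
  refine lintegral_congr_ae ?_
  filter_upwards [hmeas.ae_eq_mk] with t hwt
  have h1 : ∫⁻ s, K ((X ω, s, c), t) ∂κ =
      ∫⁻ s, (Set.Ici (t : EReal)).indicator (fun _ => if (t : EReal) ≤ c then
        ENNReal.ofReal (Real.exp (inner ℝ (X ω) β₀)) * G (t, X ω) else 0) s ∂κ := by
    refine lintegral_congr fun s => ?_
    by_cases hs : (t : EReal) ≤ s <;> simp [hK, Set.indicator, hs]
  simp only [Pi.mul_apply]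
  rw [h1, lintegral_indicator_const measurableSet_Ici, hw, ← hwt,
    ENNReal.ofReal_mul' (Real.exp_pos _).le]
  by_cases hc : (t : EReal) ≤ c
  · simp [hF₁, hc]; ring
  · simp [hF₁, hc]

/-! ### Event pairs and the two-subject likelihood -/

variable {P : ℕ}

lemma measurable_time : Measurable (Obs.time : Obs P → ℝ) := measurable_fst

lemma measurable_event : Measurable (Obs.event : Obs P → ℕ) := measurable_snd.fst

lemma measurable_cov : Measurable (Obs.cov : Obs P → Vec P) := measurable_snd.snd

/-- Pairs of observations in which the first subject has an event while the second is at risk. -/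
def eventPairs (P : ℕ) : Set (Obs P × Obs P) :=
  {z | Obs.event z.1 = 1 ∧ Obs.time z.1 ≤ Obs.time z.2}

/-- The probability that the first subject of a pair is the one with the event, given that one
of them has it. -/
noncomputable def pairLik (β : Vec P) (z : Obs P × Obs P) : ℝ :=
  Real.exp (inner ℝ (Obs.cov z.1 - Obs.cov z.2) β) /
    (1 + Real.exp (inner ℝ (Obs.cov z.1 - Obs.cov z.2) β))

lemma measurableSet_eventPairs : MeasurableSet (eventPairs P) :=
  (measurableSet_eq_fun (measurable_event.comp measurable_fst) measurable_const).inter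
    (measurableSet_le (measurable_time.comp measurable_fst) (measurable_time.comp measurable_snd))

lemma measurable_pairLik (β : Vec P) : Measurable (pairLik β) := by
  have h : Measurable fun z : Obs P × Obs P => Obs.cov z.1 - Obs.cov z.2 :=
    (measurable_cov.comp measurable_fst).sub (measurable_cov.comp measurable_snd)
  unfold pairLik
  fun_prop

lemma pairLik_pos (β : Vec P) (z : Obs P × Obs P) : 0 < pairLik β z := by
  unfold pairLik; positivity

lemma pairLik_add_pairLik_swap (β : Vec P) (z : Obs P × Obs P) :
    pairLik β z + pairLik β z.swap = 1 := by
  have h : inner ℝ (Obs.cov z.2 - Obs.cov z.1) β = -inner ℝ (Obs.cov z.1 - Obs.cov z.2) β := by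
    rw [← inner_neg_left, neg_sub]
  simp only [pairLik, Prod.fst_swap, Prod.snd_swap, h, Real.exp_neg]
  have := Real.exp_pos (inner ℝ (Obs.cov z.1 - Obs.cov z.2) β)
  field_simp
  ring

/-- At the true parameter the pair likelihood is the first relative risk over the sum of both.
Dividing by it cancels the only asymmetric factor of the pair law and leaves a symmetric one. -/
lemma exp_mul_pairLik_div (β β₀ : Vec P) (z : Obs P × Obs P) :
    Real.exp (inner ℝ (Obs.cov z.1) β₀) * (pairLik β z / pairLik β₀ z) =
      (Real.exp (inner ℝ (Obs.cov z.1) β₀) + Real.exp (inner ℝ (Obs.cov z.2) β₀)) *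
        pairLik β z := by
  have h : pairLik β₀ z = Real.exp (inner ℝ (Obs.cov z.1) β₀) /
      (Real.exp (inner ℝ (Obs.cov z.1) β₀) + Real.exp (inner ℝ (Obs.cov z.2) β₀)) := by
    rw [pairLik, inner_sub_left, Real.exp_sub]
    field_simp
    ring
  rw [h]
  field_simp

/-! ### The law of a pair on `eventPairs` -/

section PairLaw

variable {Ω : Type*} [MeasurableSpace Ω] {μ : Measure Ω} [IsProbabilityMeasure μ] {h₀ : ℝ → ℝ}
  {β₀ : Vec P} {Ts Cs : ℕ → Ω → EReal} {D : ℕ → Ω → Obs P}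

/-- The two subjects of a pair enter the law of the pair on `eventPairs` through a symmetric
weight, apart from the relative risk of the first one. -/
lemma CoxModel.exists_symm_weight (hM : CoxModel μ h₀ β₀ Ts Cs D) (i : ℕ) :
    ∃ W : Obs P × Obs P → ℝ≥0∞, Measurable W ∧ (∀ z, W z.swap = W z) ∧
      ∀ f : Vec P × Vec P → ℝ≥0∞, Measurable f →
        ∫⁻ z in eventPairs P, f (Obs.cov z.1, Obs.cov z.2)
            ∂((μ.map (D i)).prod (μ.map (D i))) =
          ∫⁻ z, W z * (ENNReal.ofReal (Real.exp (inner ℝ (Obs.cov z.1) β₀)) *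
            f (Obs.cov z.1, Obs.cov z.2)) ∂((μ.map (D i)).prod (μ.map (D i))) := by
  obtain ⟨lam, hlam, hcomp⟩ := hM.exists_compensator i
  have hD := hM.measurable_obs i
  have hmt := measurable_time (P := P)
  have hmc := measurable_cov (P := P)
  have hme := measurable_event (P := P)
  have : IsProbabilityMeasure (μ.map (D i)) := Measure.isProbabilityMeasure_map hD.aemeasurable
  set ν := μ.map (D i) with hν
  have hexp : Measurable fun d : Obs P => ENNReal.ofReal (Real.exp (inner ℝ (Obs.cov d) β₀)) := by
    fun_prop
  have hmono : Monotone fun t : ℝ => lam (Set.Iic t) := fun a b hab =>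
    measure_mono (Set.Iic_subset_Iic.2 hab)
  have hW : Measurable fun z : Obs P × Obs P =>
      lam (Set.Iic (min (Obs.time z.1) (Obs.time z.2))) :=
    hmono.measurable.comp (g := fun t : ℝ => lam (Set.Iic t))
      (f := fun z : Obs P × Obs P => min (Obs.time z.1) (Obs.time z.2)) (by fun_prop)
  -- The weight is the cumulative baseline hazard over the period in which both subjects are at
  -- risk.
  refine ⟨fun z => lam (Set.Iic (min (Obs.time z.1) (Obs.time z.2))), hW, fun z => ?_,
    fun f hf => ?_⟩
  · simp [min_comm]
  have hν_comp : ∀ G : ℝ × Vec P → ℝ≥0∞, Measurable G →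
      ∫⁻ d, (if Obs.event d = 1 then G (Obs.time d, Obs.cov d) else 0) ∂ν =
      ∫⁻ d, ∫⁻ t, (if t ≤ Obs.time d then
        ENNReal.ofReal (Real.exp (inner ℝ (Obs.cov d) β₀)) * G (t, Obs.cov d)
        else 0) ∂lam ∂ν := by
    intro G hG
    have hm1 : Measurable fun d : Obs P =>
        if Obs.event d = 1 then G (Obs.time d, Obs.cov d) else 0 :=
      Measurable.ite (measurableSet_eq_fun hme measurable_const)
        (hG.comp (hmt.prodMk hmc)) measurable_const
    have hm2 : Measurable fun z : Obs P × ℝ => if z.2 ≤ Obs.time z.1 then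
        ENNReal.ofReal (Real.exp (inner ℝ (Obs.cov z.1) β₀)) * G (z.2, Obs.cov z.1) else 0 :=
      Measurable.ite (measurableSet_le measurable_snd (hmt.comp measurable_fst))
        (by fun_prop) measurable_const
    rw [hν, lintegral_map hm1 hD, lintegral_map hm2.lintegral_prod_right' hD, ← hcomp G hG]
    refine lintegral_congr fun ω => ?_
    rw [hM.event_eq i ω]
    split_ifs <;> simp_all
  have hfz : Measurable fun z : Obs P × Obs P => f (Obs.cov z.1, Obs.cov z.2) := by fun_prop
  rw [← lintegral_indicator measurableSet_eventPairs,
    lintegral_prod_symm _ (hfz.indicator measurableSet_eventPairs).aemeasurable]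
  refine Eq.trans ?_
    (lintegral_prod_symm _ (hW.mul ((hexp.comp measurable_fst).mul hfz)).aemeasurable).symm
  refine lintegral_congr fun e => ?_
  -- With the second subject `e` frozen, the compensator formula is applied to the first;
  -- independence enters through the product measure.
  have hG : Measurable fun p : ℝ × Vec P => if p.1 ≤ Obs.time e then f (p.2, Obs.cov e) else 0 :=
    Measurable.ite (measurableSet_le measurable_fst measurable_const) (by fun_prop)
      measurable_const
  refine Eq.trans (lintegral_congr fun d => ?_) ((hν_comp _ hG).trans (lintegral_congr fun d => ?_))
  · by_cases h1 : Obs.event d = 1 <;> by_cases h2 : Obs.time d ≤ Obs.time e <;>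
      simp [eventPairs, Set.indicator, h1, h2]
  · change _ = lam (Set.Iic (min (Obs.time d) (Obs.time e))) *
      (ENNReal.ofReal (Real.exp (inner ℝ (Obs.cov d) β₀)) * f (Obs.cov d, Obs.cov e))
    rw [mul_comm (lam _), ← lintegral_indicator_const measurableSet_Iic]
    refine lintegral_congr fun t => ?_
    by_cases h1 : t ≤ Obs.time d <;> by_cases h2 : t ≤ Obs.time e <;>
      simp [Set.indicator, h1, h2]

/-- The likelihood ratio of a pair at any parameter value against the true one has mean one,
given that the pair has an event. -/
lemma CoxModel.lintegral_pairLik_div (hM : CoxModel μ h₀ β₀ Ts Cs D) (i : ℕ) (β : Vec P) :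
    ∫⁻ z in eventPairs P, ENNReal.ofReal (pairLik β z / pairLik β₀ z)
        ∂((μ.map (D i)).prod (μ.map (D i))) =
      (μ.map (D i)).prod (μ.map (D i)) (eventPairs P) := by
  obtain ⟨W, hW, hWs, hWf⟩ := hM.exists_symm_weight i
  have hD := hM.measurable_obs i
  have hmc := measurable_cov (P := P)
  have : IsProbabilityMeasure (μ.map (D i)) := Measure.isProbabilityMeasure_map hD.aemeasurable
  set ν := μ.map (D i) with hν
  set S : Obs P × Obs P → ℝ := fun z =>
    Real.exp (inner ℝ (Obs.cov z.1) β₀) + Real.exp (inner ℝ (Obs.cov z.2) β₀) with hS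
  have hSs : ∀ z, S z.swap = S z := fun z => by simp [hS, add_comm]
  have hS0 : ∀ z, 0 ≤ S z := fun z => by positivity
  have hSm : Measurable S := by fun_prop
  have hpm := fun β => measurable_pairLik (P := P) β
  have key : ∀ β, ∫⁻ z in eventPairs P, ENNReal.ofReal (pairLik β z / pairLik β₀ z) ∂(ν.prod ν) =
      ∫⁻ z, W z * ENNReal.ofReal (S z * pairLik β z) ∂(ν.prod ν) := by
    intro β
    have := hWf (fun p => ENNReal.ofReal
      (pairLik β ((0, 0, p.1), (0, 0, p.2)) / pairLik β₀ ((0, 0, p.1), (0, 0, p.2)))) (by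
        have hm : Measurable fun p : Vec P × Vec P =>
          (((0 : ℝ), (0 : ℕ), p.1), ((0 : ℝ), (0 : ℕ), p.2)) := by fun_prop
        exact (((hpm β).comp hm).div ((hpm β₀).comp hm)).ennreal_ofReal)
    refine Eq.trans this (lintegral_congr fun z => ?_)
    rw [← ENNReal.ofReal_mul (Real.exp_pos _).le]
    exact congrArg (fun x => W z * ENNReal.ofReal x) (exp_mul_pairLik_div β β₀ z)
  -- Adding the integral to its image under the swap replaces `pairLik` by 1, so the value does not
  -- depend on `β`. Comparison with `β₀`, where the ratio is 1, then identifies it.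
  have htwo : ∀ β, 2 * ∫⁻ z, W z * ENNReal.ofReal (S z * pairLik β z) ∂(ν.prod ν) =
      ∫⁻ z, W z * ENNReal.ofReal (S z) ∂(ν.prod ν) := by
    intro β
    have hm : Measurable fun z => W z * ENNReal.ofReal (S z * pairLik β z) :=
      hW.mul (hSm.mul (hpm β)).ennreal_ofReal
    rw [two_mul]
    nth_rewrite 2 [← lintegral_prod_swap]
    rw [← lintegral_add_left hm]
    refine lintegral_congr fun z => ?_
    rw [hWs, hSs, ← mul_add, ← ENNReal.ofReal_add (mul_nonneg (hS0 z) (pairLik_pos β z).le)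
      (mul_nonneg (hS0 z) (pairLik_pos β _).le), ← mul_add, pairLik_add_pairLik_swap, mul_one]
  have h1 : ∫⁻ z in eventPairs P, ENNReal.ofReal (pairLik β₀ z / pairLik β₀ z) ∂(ν.prod ν) =
      ν.prod ν (eventPairs P) := by
    rw [← setLIntegral_one]
    exact lintegral_congr fun z => by rw [div_self (pairLik_pos β₀ z).ne', ENNReal.ofReal_one]
  rw [← h1, key β, key β₀]
  exact (ENNReal.mul_right_inj two_ne_zero ENNReal.ofNat_ne_top).1 ((htwo β).trans (htwo β₀).symm)

/-! ### The square-root contrast and the sign of its mean -/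

/-- Twice the Hellinger-type contrast `√(p(β)/p(β₀)) - 1` of a pair, which dominates the log
likelihood ratio. -/
noncomputable def pairContrast (β₀ β : Vec P) (z : Obs P × Obs P) : ℝ :=
  2 * (√(pairLik β z / pairLik β₀ z) - 1)

lemma measurable_pairContrast (β₀ β : Vec P) : Measurable (pairContrast β₀ β) :=
  measurable_const.mul
    ((((measurable_pairLik β).div (measurable_pairLik β₀)).sqrt).sub measurable_const)

/-- Write log r = 2 log √r and use log x ≤ x - 1. -/
lemma log_pairLik_sub_le (β₀ β : Vec P) (z : Obs P × Obs P) :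
    Real.log (pairLik β z) - Real.log (pairLik β₀ z) ≤ pairContrast β₀ β z := by
  have h := div_pos (pairLik_pos β z) (pairLik_pos β₀ z)
  rw [← Real.log_div (pairLik_pos β z).ne' (pairLik_pos β₀ z).ne']
  have h1 := Real.log_le_sub_one_of_pos (Real.sqrt_pos.2 h)
  rw [Real.log_sqrt h.le] at h1
  unfold pairContrast
  linarith

/-- This is 2(√r - 1) = (r - 1) - (√r - 1)². Since r - 1 has integral zero over `eventPairs`, the
mean contrast is minus a squared Hellinger-type distance. -/
lemma pairContrast_sq_add (β₀ β : Vec P) (z : Obs P × Obs P) :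
    pairContrast β₀ β z = pairLik β z / pairLik β₀ z - 1 - (pairContrast β₀ β z) ^ 2 / 4 := by
  have h := Real.sq_sqrt (div_pos (pairLik_pos β z) (pairLik_pos β₀ z)).le
  unfold pairContrast
  nlinarith

lemma CoxModel.integrable_pairLik_div (hM : CoxModel μ h₀ β₀ Ts Cs D) (i : ℕ) (β : Vec P) :
    IntegrableOn (fun z => pairLik β z / pairLik β₀ z) (eventPairs P)
      ((μ.map (D i)).prod (μ.map (D i))) := by
  have : IsProbabilityMeasure (μ.map (D i)) :=
    Measure.isProbabilityMeasure_map (hM.measurable_obs i).aemeasurable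
  refine ⟨((measurable_pairLik β).div (measurable_pairLik β₀)).aestronglyMeasurable, ?_⟩
  rw [hasFiniteIntegral_iff_ofReal
    (Eventually.of_forall fun z => (div_pos (pairLik_pos β z) (pairLik_pos β₀ z)).le),
    hM.lintegral_pairLik_div i β]
  exact measure_lt_top _ _

/-- The square of the contrast is at most 4(r + 1), and the ratio r is integrable; no moment of the
covariates is needed. -/
lemma CoxModel.memLp_indicator_pairContrast (hM : CoxModel μ h₀ β₀ Ts Cs D) (i : ℕ) (β : Vec P) :
    MemLp ((eventPairs P).indicator (pairContrast β₀ β)) 2 ((μ.map (D i)).prod (μ.map (D i))) := by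
  have : IsProbabilityMeasure (μ.map (D i)) :=
    Measure.isProbabilityMeasure_map (hM.measurable_obs i).aemeasurable
  rw [memLp_indicator_iff_restrict measurableSet_eventPairs,
    memLp_two_iff_integrable_sq (measurable_pairContrast β₀ β).aestronglyMeasurable]
  refine (((hM.integrable_pairLik_div i β).add (integrable_const 1)).const_mul 4).mono'
    ((measurable_pairContrast β₀ β).pow_const 2).aestronglyMeasurable
    (Eventually.of_forall fun z => ?_)
  have h := div_pos (pairLik_pos β z) (pairLik_pos β₀ z)
  have h1 := Real.sqrt_nonneg (pairLik β z / pairLik β₀ z)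
  have h2 := Real.sq_sqrt h.le
  rw [Real.norm_of_nonneg (sq_nonneg _)]
  simp only [Pi.add_apply, pairContrast]
  nlinarith

/-- The mean contrast is negative unless the two likelihoods agree on `eventPairs`. -/
lemma CoxModel.integral_pairContrast_neg (hM : CoxModel μ h₀ β₀ Ts Cs D) (i : ℕ) (β : Vec P)
    (hne : ¬ ∀ᵐ z ∂((μ.map (D i)).prod (μ.map (D i))), z ∈ eventPairs P →
      inner ℝ (Obs.cov z.1 - Obs.cov z.2) (β - β₀) = 0) :
    ∫ z, (eventPairs P).indicator (pairContrast β₀ β) z ∂((μ.map (D i)).prod (μ.map (D i))) < 0 := by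
  have : IsProbabilityMeasure (μ.map (D i)) :=
    Measure.isProbabilityMeasure_map (hM.measurable_obs i).aemeasurable
  have hL := (memLp_indicator_iff_restrict measurableSet_eventPairs).1
    (hM.memLp_indicator_pairContrast i β)
  set Q := ((μ.map (D i)).prod (μ.map (D i))).restrict (eventPairs P) with hQ
  have hr : Integrable (fun z => pairLik β z / pairLik β₀ z) Q := hM.integrable_pairLik_div i β
  have hsq : Integrable (fun z => pairContrast β₀ β z ^ 2) Q := hL.integrable_sq
  have hone : ∫ z, pairLik β z / pairLik β₀ z ∂Q = Q.real Set.univ := by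
    rw [integral_eq_lintegral_of_nonneg_ae
      (Eventually.of_forall fun z => (div_pos (pairLik_pos β z) (pairLik_pos β₀ z)).le)
      ((measurable_pairLik β).div (measurable_pairLik β₀)).aestronglyMeasurable,
      hM.lintegral_pairLik_div i β, measureReal_def, hQ, Measure.restrict_apply_univ]
  rw [integral_indicator measurableSet_eventPairs, ← hQ,
    integral_congr_ae (Eventually.of_forall (pairContrast_sq_add β₀ β)),
    integral_sub (f := fun z => pairLik β z / pairLik β₀ z - 1) (hr.sub (integrable_const 1))
      (hsq.div_const 4), integral_sub hr (integrable_const 1), hone, integral_const, smul_eq_mul, mul_one, sub_self,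
    zero_sub, neg_lt_zero, integral_div]
  -- A zero second moment forces the two pair likelihoods to coincide almost everywhere on
  -- `eventPairs`, and the logistic function is injective.
  refine div_pos (lt_of_le_of_ne (integral_nonneg fun z => sq_nonneg _) fun h0 => hne ?_) four_pos
  rw [eq_comm, integral_eq_zero_iff_of_nonneg (fun z => sq_nonneg _) hsq] at h0
  filter_upwards [(ae_restrict_iff' measurableSet_eventPairs).1 h0] with z hz hzE
  have h1 : pairContrast β₀ β z = 0 := by simpa using hz hzE
  have h2 : pairLik β z = pairLik β₀ z := by
    have h3 := pairContrast_sq_add β₀ β z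
    rw [h1] at h3
    have h4 : pairLik β z / pairLik β₀ z = 1 := by linarith
    rwa [div_eq_one_iff_eq (pairLik_pos β₀ z).ne'] at h4
  unfold pairLik at h2
  rw [div_eq_div_iff (by positivity) (by positivity)] at h2
  have h5 : Real.exp (inner ℝ (Obs.cov z.1 - Obs.cov z.2) β) =
      Real.exp (inner ℝ (Obs.cov z.1 - Obs.cov z.2) β₀) := by linarith
  rw [inner_sub_right, Real.exp_injective h5, sub_self]

end PairLaw

/-! ### A weak law for U-statistics of order two -/

section UStatistic

variable {Ω α : Type*} [MeasurableSpace Ω] [MeasurableSpace α] {μ : Measure Ω}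
  [IsProbabilityMeasure μ] {D : ℕ → Ω → α} {ψ : α × α → ℝ}

lemma map_pair_eq_prod (hD : ∀ i, Measurable (D i)) (hind : iIndepFun D μ)
    (hid : ∀ i, IdentDistrib (D i) (D 0) μ μ) {i j : ℕ} (hij : i ≠ j) :
    μ.map (fun ω => (D i ω, D j ω)) = (μ.map (D 0)).prod (μ.map (D 0)) := by
  rw [(indepFun_iff_map_prod_eq_prod_map_map (hD i).aemeasurable (hD j).aemeasurable).1
    (hind.indepFun hij), (hid i).map_eq, (hid j).map_eq]

/-- The second moment of a centred sum over the ordered pairs of distinct indices below `n` is of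
order `n ^ 3`. -/
lemma integral_sq_sum_pairs_le (hD : ∀ i, Measurable (D i)) (hind : iIndepFun D μ)
    (hid : ∀ i, IdentDistrib (D i) (D 0) μ μ) (hψ : Measurable ψ)
    (hψ2 : MemLp ψ 2 ((μ.map (D 0)).prod (μ.map (D 0))))
    (hψ0 : ∫ z, ψ z ∂((μ.map (D 0)).prod (μ.map (D 0))) = 0) (n : ℕ) :
    MemLp (fun ω => ∑ i ∈ Finset.range n, ∑ j ∈ (Finset.range n).erase i, ψ (D i ω, D j ω)) 2 μ ∧
    ∫ ω, (∑ i ∈ Finset.range n, ∑ j ∈ (Finset.range n).erase i, ψ (D i ω, D j ω)) ^ 2 ∂μ ≤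
      4 * (n : ℝ) ^ 3 * ∫ z, ψ z ^ 2 ∂((μ.map (D 0)).prod (μ.map (D 0))) := by
  set V := ∫ z, ψ z ^ 2 ∂((μ.map (D 0)).prod (μ.map (D 0))) with hV
  have hV0 : 0 ≤ V := integral_nonneg fun z => sq_nonneg _
  have hpair : ∀ i j, Measurable fun ω => (D i ω, D j ω) := fun i j => (hD i).prodMk (hD j)
  -- Zero on the diagonal, so that all sums run over full squares of indices.
  set Z : ℕ → ℕ → Ω → ℝ := fun i j ω => if j = i then 0 else ψ (D i ω, D j ω) with hZ
  have hsum : ∀ ω, ∑ i ∈ Finset.range n, ∑ j ∈ (Finset.range n).erase i, ψ (D i ω, D j ω) =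
      ∑ i ∈ Finset.range n, ∑ j ∈ Finset.range n, Z i j ω := by
    intro ω
    refine Finset.sum_congr rfl fun i _ => ?_
    rw [← Finset.filter_ne', Finset.sum_filter]
    refine Finset.sum_congr rfl fun j _ => ?_
    by_cases h : j = i <;> simp [hZ, h]
  have hZne : ∀ i j, j ≠ i → Z i j = fun ω => ψ (D i ω, D j ω) := by
    intro i j h
    ext ω
    simp [hZ, h]
  have hZeq : ∀ i, Z i i = 0 := by
    intro i
    ext ω
    simp [hZ]
  have hZL : ∀ i j, MemLp (Z i j) 2 μ := by
    intro i j
    by_cases h : j = i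
    · subst h
      rw [hZeq]
      exact MemLp.zero
    · rw [hZne i j h]
      rw [← map_pair_eq_prod hD hind hid (Ne.symm h)] at hψ2
      exact hψ2.comp_of_map (hpair i j).aemeasurable
  have hZV : ∀ i j, ∫ ω, Z i j ω ^ 2 ∂μ ≤ V := by
    intro i j
    by_cases h : j = i
    · subst h
      simpa [hZeq] using hV0
    · rw [hZne i j h, hV, ← map_pair_eq_prod hD hind hid (Ne.symm h),
        integral_map (hpair i j).aemeasurable (hψ.pow_const 2).aestronglyMeasurable]
  have hZ0 : ∀ i j, ∫ ω, Z i j ω ∂μ = 0 := by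
    intro i j
    by_cases h : j = i
    · subst h
      simp [hZeq]
    · rw [hZne i j h, ← hψ0, ← map_pair_eq_prod hD hind hid (Ne.symm h),
        integral_map (hpair i j).aemeasurable hψ.aestronglyMeasurable]
  have hprod : ∀ i j k l, Integrable (fun ω => Z i j ω * Z k l ω) μ := fun i j k l =>
    (hZL i j).integrable_mul (hZL k l)
  have hcov_le : ∀ i j k l, ∫ ω, Z i j ω * Z k l ω ∂μ ≤ V := by
    intro i j k l
    have h1 : ∫ ω, Z i j ω * Z k l ω ∂μ ≤ ∫ ω, (Z i j ω ^ 2 / 2 + Z k l ω ^ 2 / 2) ∂μ :=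
      integral_mono (hprod i j k l)
        (((hZL i j).integrable_sq.div_const 2).add ((hZL k l).integrable_sq.div_const 2))
        fun ω => by nlinarith [sq_nonneg (Z i j ω - Z k l ω)]
    rw [integral_add ((hZL i j).integrable_sq.div_const 2) ((hZL k l).integrable_sq.div_const 2),
      integral_div, integral_div] at h1
    linarith [hZV i j, hZV k l]
  have hcov0 : ∀ i j k l, i ≠ k → i ≠ l → j ≠ k → j ≠ l → ∫ ω, Z i j ω * Z k l ω ∂μ = 0 := by
    intro i j k l hik hil hjk hjl
    by_cases hij : j = i
    · subst hij
      simp [hZeq]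
    by_cases hkl : l = k
    · subst hkl
      simp [hZeq]
    have hI : IndepFun (Z i j) (Z k l) μ := by
      rw [hZne i j hij, hZne k l hkl]
      exact (hind.indepFun_prodMk_prodMk hD i j k l hik hil hjk hjl).comp hψ hψ
    have := hI.integral_mul_eq_mul_integral (hZL i j).aestronglyMeasurable
      (hZL k l).aestronglyMeasurable
    simpa [hZ0] using this
  -- Pairs without a common index are uncorrelated. Each of the four possible coincidences leaves
  -- three free indices, whence the bound `4 * n ^ 3 * V`.
  have hcov : ∀ i j k l, ∫ ω, Z i j ω * Z k l ω ∂μ ≤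
      (if i = k then V else 0) + (if i = l then V else 0) + (if j = k then V else 0) +
        (if j = l then V else 0) := by
    intro i j k l
    by_cases h : i ≠ k ∧ i ≠ l ∧ j ≠ k ∧ j ≠ l
    · rw [hcov0 i j k l h.1 h.2.1 h.2.2.1 h.2.2.2]
      simp [h]
    · refine (hcov_le i j k l).trans ?_
      have h1 : ∀ p : Prop, [Decidable p] → 0 ≤ if p then V else 0 := fun p _ => by
        split_ifs <;> simp [hV0]
      have hik := h1 (i = k)
      have hil := h1 (i = l)
      have hjk := h1 (j = k)
      have hjl := h1 (j = l)
      by_cases e1 : i = k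
      · rw [if_pos e1]; linarith
      by_cases e2 : i = l
      · rw [if_pos e2]; linarith
      by_cases e3 : j = k
      · rw [if_pos e3]; linarith
      by_cases e4 : j = l
      · rw [if_pos e4]; linarith
      exact absurd ⟨e1, e2, e3, e4⟩ h
  simp_rw [hsum]
  refine ⟨memLp_finsetSum _ fun i _ => memLp_finsetSum _ fun j _ => hZL i j, ?_⟩
  have hexpand : ∀ ω, (∑ i ∈ Finset.range n, ∑ j ∈ Finset.range n, Z i j ω) ^ 2 =
      ∑ i ∈ Finset.range n, ∑ j ∈ Finset.range n, ∑ k ∈ Finset.range n, ∑ l ∈ Finset.range n,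
        Z i j ω * Z k l ω := by
    intro ω
    simp_rw [sq, Finset.sum_mul, Finset.mul_sum]
  simp_rw [hexpand]
  rw [integral_finsetSum _ fun i _ => integrable_finsetSum _ fun j _ => integrable_finsetSum _
    fun k _ => integrable_finsetSum _ fun l _ => hprod i j k l]
  have hsumle : ∑ i ∈ Finset.range n, ∫ ω, ∑ j ∈ Finset.range n, ∑ k ∈ Finset.range n,
      ∑ l ∈ Finset.range n, Z i j ω * Z k l ω ∂μ ≤
      ∑ i ∈ Finset.range n, ∑ j ∈ Finset.range n, ∑ k ∈ Finset.range n, ∑ l ∈ Finset.range n,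
      ((if i = k then V else 0) + (if i = l then V else 0) + (if j = k then V else 0) +
        (if j = l then V else 0)) := by
    refine Finset.sum_le_sum fun i _ => ?_
    rw [integral_finsetSum _ fun j _ => integrable_finsetSum _
      fun k _ => integrable_finsetSum _ fun l _ => hprod i j k l]
    refine Finset.sum_le_sum fun j _ => ?_
    rw [integral_finsetSum _ fun k _ => integrable_finsetSum _ fun l _ => hprod i j k l]
    refine Finset.sum_le_sum fun k _ => ?_
    rw [integral_finsetSum _ fun l _ => hprod i j k l]
    exact Finset.sum_le_sum fun l _ => hcov i j k l
  refine hsumle.trans (le_of_eq ?_)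
  have e : ∀ a ∈ Finset.range n, ∑ k ∈ Finset.range n, (if a = k then V else 0) = V := by
    intro a ha
    rw [Finset.sum_ite_eq, if_pos ha]
  have step : ∀ i ∈ Finset.range n, ∀ j ∈ Finset.range n,
      ∑ k ∈ Finset.range n, ∑ l ∈ Finset.range n,
      ((if i = k then V else 0) + (if i = l then V else 0) + (if j = k then V else 0) +
        (if j = l then V else 0)) = 4 * n * V := by
    intro i hi j hj
    simp only [Finset.sum_add_distrib, Finset.sum_const, Finset.card_range, nsmul_eq_mul,
      ← Finset.mul_sum, e i hi, e j hj]
    ring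
  rw [Finset.sum_congr rfl fun i hi => Finset.sum_congr rfl fun j hj => step i hi j hj]
  simp only [Finset.sum_const, Finset.card_range, nsmul_eq_mul]
  ring

/-- Weak law of large numbers for `U`-statistics of order two with a square integrable kernel, as
an upper bound. -/
lemma tendsto_measure_sum_pairs_ge (hD : ∀ i, Measurable (D i)) (hind : iIndepFun D μ)
    (hid : ∀ i, IdentDistrib (D i) (D 0) μ μ) (hψ : Measurable ψ)
    (hψ2 : MemLp ψ 2 ((μ.map (D 0)).prod (μ.map (D 0)))) {c : ℝ}
    (hc : ∫ z, ψ z ∂((μ.map (D 0)).prod (μ.map (D 0))) < c) :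
    Tendsto (fun n : ℕ => μ {ω | c * ((n : ℝ) * (n - 1)) ≤
      ∑ i ∈ Finset.range n, ∑ j ∈ (Finset.range n).erase i, ψ (D i ω, D j ω)}) atTop (𝓝 0) := by
  have : IsProbabilityMeasure (μ.map (D 0)) :=
    Measure.isProbabilityMeasure_map (hD 0).aemeasurable
  set θ := ∫ z, ψ z ∂((μ.map (D 0)).prod (μ.map (D 0))) with hθ
  set η := c - θ with hη
  have hηpos : 0 < η := by rw [hη]; linarith
  have hint : Integrable ψ ((μ.map (D 0)).prod (μ.map (D 0))) := hψ2.integrable one_le_two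
  set φ : α × α → ℝ := fun z => ψ z - θ with hφ
  have hφ2 : MemLp φ 2 ((μ.map (D 0)).prod (μ.map (D 0))) := hψ2.sub (memLp_const θ)
  have hφ0 : ∫ z, φ z ∂((μ.map (D 0)).prod (μ.map (D 0))) = 0 := by
    rw [hφ, integral_sub hint (integrable_const θ)]
    simp [hθ]
  have hφm : Measurable φ := hψ.sub_const θ
  set V := ∫ z, φ z ^ 2 ∂((μ.map (D 0)).prod (μ.map (D 0))) with hV
  have hbound : ∀ n : ℕ, 2 ≤ n → μ {ω | c * ((n : ℝ) * (n - 1)) ≤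
      ∑ i ∈ Finset.range n, ∑ j ∈ (Finset.range n).erase i, ψ (D i ω, D j ω)} ≤
      ENNReal.ofReal (16 * V / η ^ 2 * (n : ℝ)⁻¹) := by
    intro n hn
    have hn' : (2 : ℝ) ≤ n := by exact_mod_cast hn
    obtain ⟨hL, hle⟩ := integral_sq_sum_pairs_le hD hind hid hφm hφ2 hφ0 n
    set U : Ω → ℝ := fun ω =>
      ∑ i ∈ Finset.range n, ∑ j ∈ (Finset.range n).erase i, φ (D i ω, D j ω) with hU
    have hUeq : ∀ ω, U ω = (∑ i ∈ Finset.range n, ∑ j ∈ (Finset.range n).erase i,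
        ψ (D i ω, D j ω)) - θ * ((n : ℝ) * (n - 1)) := by
      intro ω
      simp only [hU, hφ, Finset.sum_sub_distrib, Finset.sum_const, nsmul_eq_mul]
      congr 1
      rw [Finset.sum_congr rfl fun i hi => by rw [Finset.card_erase_of_mem hi, Finset.card_range]]
      simp only [Finset.sum_const, Finset.card_range, nsmul_eq_mul]
      rw [Nat.cast_sub (by omega)]
      push_cast
      ring
    set a : ℝ := (η * ((n : ℝ) * (n - 1))) ^ 2 with ha
    have hapos : 0 < a := by
      have : (0 : ℝ) < n - 1 := by linarith
      positivity
    have hsub : {ω | c * ((n : ℝ) * (n - 1)) ≤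
        ∑ i ∈ Finset.range n, ∑ j ∈ (Finset.range n).erase i, ψ (D i ω, D j ω)} ⊆
        {ω | a ≤ U ω ^ 2} := by
      intro ω hω
      have h1 : 0 ≤ η * ((n : ℝ) * (n - 1)) := by
        have : (0 : ℝ) ≤ n - 1 := by linarith
        positivity
      have h2 : η * ((n : ℝ) * (n - 1)) ≤ U ω := by
        rw [hUeq, hη]
        have := Set.mem_ofPred_eq ▸ hω
        linarith
      exact pow_le_pow_left₀ h1 h2 2
    -- Chebyshev gives 4n³V / (η n(n-1))², which is at most 16V / (η² n) because n ≤ 2(n - 1) for n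
    -- ≥ 2.
    have hmarkov := mul_meas_ge_le_integral_of_nonneg
      (Eventually.of_forall fun ω => sq_nonneg (U ω)) hL.integrable_sq a
    refine (measure_mono hsub).trans ?_
    rw [← ofReal_measureReal]
    refine ENNReal.ofReal_le_ofReal ?_
    have hV0 : 0 ≤ V := integral_nonneg fun z => sq_nonneg _
    have h3 : μ.real {ω | a ≤ U ω ^ 2} ≤ 4 * (n : ℝ) ^ 3 * V / a := by
      rw [le_div_iff₀ hapos, mul_comm]
      exact hmarkov.trans hle
    refine h3.trans ?_
    rw [div_le_iff₀ hapos]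
    have h4 : 16 * V / η ^ 2 * (n : ℝ)⁻¹ * a = 16 * V * n * (n - 1) ^ 2 := by
      rw [ha]
      field_simp
    rw [h4]
    have h5 : (n : ℝ) ^ 2 ≤ 4 * (n - 1) ^ 2 := by nlinarith
    have h6 := mul_le_mul_of_nonneg_left h5 (show 0 ≤ 4 * V * n by positivity)
    nlinarith
  have hlim : Tendsto (fun n : ℕ => ENNReal.ofReal (16 * V / η ^ 2 * (n : ℝ)⁻¹)) atTop (𝓝 0) := by
    have h1 := (tendsto_inv_atTop_nhds_zero_nat (𝕜 := ℝ)).const_mul (16 * V / η ^ 2)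
    rw [mul_zero] at h1
    simpa using ENNReal.tendsto_ofReal h1
  refine tendsto_of_tendsto_of_tendsto_of_le_of_le' tendsto_const_nhds hlim
    (Eventually.of_forall fun n => zero_le) ?_
  filter_upwards [eventually_ge_atTop 2] with n hn using hbound n hn

end UStatistic

/-! ### Sample likelihoods: maximizers, concavity, invariance -/

lemma pairProb_eq_pairLik (D : ℕ → Obs P) (i j : ℕ) (β : Vec P) :
    pairProb D i j β = pairLik β (D i, D j) := rfl

lemma pairProb_pos (D : ℕ → Obs P) (i j : ℕ) (β : Vec P) : 0 < pairProb D i j β :=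
  pairLik_pos β (D i, D j)

lemma continuous_pairProb (D : ℕ → Obs P) (i j : ℕ) : Continuous (pairProb D i j) := by
  unfold pairProb
  refine Continuous.div (by fun_prop) (by fun_prop) fun β => by positivity

lemma exists_isMaxCPLEstimate {B : Set (Vec P)} (hB : IsCompact B) (hne : B.Nonempty) (n : ℕ)
    (D : ℕ → Obs P) : ∃ b, IsMaxCPLEstimate B n D b := by
  have hc : Continuous (compositePartialLik n D) := by
    unfold compositePartialLik
    exact continuous_finsetProd _ fun i _ => continuous_finsetProd _ fun j _ =>
      (continuous_pairProb D i j).pow _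
  exact hB.exists_isMaxOn hne hc.continuousOn

lemma compositePartialLik_pos (n : ℕ) (D : ℕ → Obs P) (β : Vec P) :
    0 < compositePartialLik n D β :=
  Finset.prod_pos fun i _ => Finset.prod_pos fun j _ => pow_pos (pairProb_pos D i j β) _

lemma log_compositePartialLik (n : ℕ) (D : ℕ → Obs P) (β : Vec P) :
    Real.log (compositePartialLik n D β) = logCPL n D β := by
  unfold compositePartialLik logCPL
  rw [Real.log_prod fun i _ => (Finset.prod_pos fun j _ => pow_pos (pairProb_pos D i j β) _).ne']
  refine Finset.sum_congr rfl fun i _ => ?_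
  rw [Real.log_prod fun j _ => (pow_pos (pairProb_pos D i j β) _).ne']
  exact Finset.sum_congr rfl fun j _ => Real.log_pow _ _

lemma IsMaxCPLEstimate.logCPL_le {B : Set (Vec P)} {n : ℕ} {D : ℕ → Obs P} {b β : Vec P}
    (hb : IsMaxCPLEstimate B n D b) (hβ : β ∈ B) : logCPL n D β ≤ logCPL n D b := by
  rw [← log_compositePartialLik, ← log_compositePartialLik]
  exact Real.log_le_log (compositePartialLik_pos n D β) (hb.2 hβ)

/-- The function is u - log(1 + eᵘ), and the subtracted term has the increasing logistic function as
derivative. -/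
lemma concaveOn_log_exp_div : ConcaveOn ℝ Set.univ
    fun u : ℝ => Real.log (Real.exp u / (1 + Real.exp u)) := by
  have hd : ∀ u : ℝ, HasDerivAt (fun u : ℝ => Real.log (1 + Real.exp u))
      (Real.exp u / (1 + Real.exp u)) u := fun u =>
    ((Real.hasDerivAt_exp u).const_add 1).log (by positivity)
  have hconv : ConvexOn ℝ Set.univ fun u : ℝ => Real.log (1 + Real.exp u) := by
    refine Monotone.convexOn_univ_of_deriv (fun u => (hd u).differentiableAt) fun u v huv => ?_
    rw [(hd u).deriv, (hd v).deriv, div_le_div_iff₀ (by positivity) (by positivity)]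
    nlinarith [Real.exp_le_exp.2 huv]
  refine ((concaveOn_id convex_univ).sub hconv).congr fun u _ => ?_
  rw [Real.log_div (Real.exp_pos u).ne' (by positivity), Real.log_exp]
  rfl

lemma concaveOn_logCPL (n : ℕ) (D : ℕ → Obs P) : ConcaveOn ℝ Set.univ (logCPL n D) := by
  refine ⟨convex_univ, fun x _ y _ a b ha hb hab => ?_⟩
  simp only [logCPL, Finset.smul_sum]
  rw [← Finset.sum_add_distrib]
  refine Finset.sum_le_sum fun i _ => ?_
  rw [← Finset.sum_add_distrib]
  refine Finset.sum_le_sum fun j _ => ?_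
  have h := concaveOn_log_exp_div.2 (Set.mem_univ (inner ℝ (Obs.cov (D i) - Obs.cov (D j)) x))
    (Set.mem_univ (inner ℝ (Obs.cov (D i) - Obs.cov (D j)) y)) ha hb hab
  have h2 := mul_le_mul_of_nonneg_left h (Nat.cast_nonneg (α := ℝ) (Obs.event (D i)))
  simp only [pairProb, inner_add_right, inner_smul_right]
  simp only [smul_eq_mul] at h2 ⊢
  linarith

/-- Moves from log-ratios, possibly without moments, to a sum over ordered pairs with a square
integrable kernel. -/
lemma logCPL_sub_le (n : ℕ) {D : ℕ → Obs P} (hD : ∀ i, Obs.event (D i) = 0 ∨ Obs.event (D i) = 1)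
    (β₀ β : Vec P) :
    logCPL n D β - logCPL n D β₀ ≤ ∑ i ∈ Finset.range n, ∑ j ∈ (Finset.range n).erase i,
      (eventPairs P).indicator (pairContrast β₀ β) (D i, D j) := by
  unfold logCPL
  rw [← Finset.sum_sub_distrib]
  refine Finset.sum_le_sum fun i _ => ?_
  rw [← Finset.sum_sub_distrib, riskSet, ← Finset.filter_erase, Finset.sum_filter]
  refine Finset.sum_le_sum fun j _ => ?_
  have h := log_pairLik_sub_le β₀ β (D i, D j)
  rcases hD i with h0 | h1
  · simp [eventPairs, h0]
  · by_cases ht : Obs.time (D i) ≤ Obs.time (D j)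
    · simpa [eventPairs, h1, ht, pairProb_eq_pairLik] using h
    · simp [eventPairs, ht]

/-- Within the risk set of an event all covariates have the same inner product with `v`, so the
shift multiplies numerator and denominator of each factor alike. -/
lemma logPL_add_eq {n : ℕ} {D : ℕ → Obs P} {v : Vec P}
    (h : ∀ i j, Obs.event (D i) ≠ 0 → Obs.time (D i) ≤ Obs.time (D j) →
      inner ℝ (Obs.cov (D i) - Obs.cov (D j)) v = 0) (x : Vec P) :
    logPL n D (x + v) = logPL n D x := by
  unfold logPL
  refine Finset.sum_congr rfl fun i hi => ?_
  by_cases h0 : Obs.event (D i) = 0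
  · simp [h0]
  congr 1
  have hmem : i ∈ riskSet n D (Obs.time (D i)) := by simpa [riskSet] using hi
  have hsum : ∑ j ∈ riskSet n D (Obs.time (D i)), Real.exp (inner ℝ (Obs.cov (D j)) (x + v)) =
      Real.exp (inner ℝ (Obs.cov (D i)) v) *
        ∑ j ∈ riskSet n D (Obs.time (D i)), Real.exp (inner ℝ (Obs.cov (D j)) x) := by
    rw [Finset.mul_sum]
    refine Finset.sum_congr rfl fun j hj => ?_
    have h1 := h i j h0 (Finset.mem_filter.1 hj).2
    rw [inner_sub_left, sub_eq_zero] at h1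
    rw [inner_add_right, ← h1, ← Real.exp_add, add_comm]
  have hpos : 0 < ∑ j ∈ riskSet n D (Obs.time (D i)), Real.exp (inner ℝ (Obs.cov (D j)) x) :=
    Finset.sum_pos (fun j _ => Real.exp_pos _) ⟨i, hmem⟩
  rw [hsum, Real.log_mul (Real.exp_pos _).ne' hpos.ne', Real.log_exp, inner_add_right]
  ring

lemma scorePL_add_eq {n : ℕ} {D : ℕ → Obs P} {v : Vec P}
    (h : ∀ i j, Obs.event (D i) ≠ 0 → Obs.time (D i) ≤ Obs.time (D j) →
      inner ℝ (Obs.cov (D i) - Obs.cov (D j)) v = 0) (x : Vec P) :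
    scorePL n D (x + v) = scorePL n D x := by
  unfold scorePL gradient
  rw [← fderiv_comp_add_right, funext (logPL_add_eq h)]

/-- A strict decrease on a sphere confines the points where a concave function is at least its
value at the centre. -/
lemma dist_le_of_concaveOn {E : Type*} [NormedAddCommGroup E] [NormedSpace ℝ E] {f : E → ℝ}
    (hf : ConcaveOn ℝ Set.univ f) {x₀ b : E} {r : ℝ} (hr : 0 < r)
    (hlt : ∀ x ∈ Metric.sphere x₀ r, f x < f x₀) (hb : f x₀ ≤ f b) : dist b x₀ ≤ r := by
  by_contra! hlt'
  have hpos : 0 < dist b x₀ := hr.trans hlt'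
  set t := r / dist b x₀ with ht
  have ht0 : 0 < t := div_pos hr hpos
  have ht1 : t < 1 := (div_lt_one hpos).2 hlt'
  have hmem : (1 - t) • x₀ + t • b ∈ Metric.sphere x₀ r := by
    rw [mem_sphere_iff_norm, show (1 - t) • x₀ + t • b - x₀ = t • (b - x₀) by module, norm_smul,
      Real.norm_of_nonneg ht0.le, ← dist_eq_norm, ht, div_mul_cancel₀ _ hpos.ne']
  have h1 := hf.2 (Set.mem_univ x₀) (Set.mem_univ b) (sub_nonneg.2 ht1.le) ht0.le (by ring)
  have h2 := hlt _ hmem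
  simp only [smul_eq_mul] at h1
  nlinarith

lemma CoxModel.event_eq_zero_or_one {Ω : Type*} [MeasurableSpace Ω] {μ : Measure Ω}
    {h₀ : ℝ → ℝ} {β₀ : Vec P} {Ts Cs : ℕ → Ω → EReal} {D : ℕ → Ω → Obs P}
    (hM : CoxModel μ h₀ β₀ Ts Cs D) (i : ℕ) (ω : Ω) :
    Obs.event (D i ω) = 0 ∨ Obs.event (D i ω) = 1 := by
  rw [hM.event_eq]
  split_ifs <;> simp

/-! ### Identifiability and uniform separation on a sphere -/

section Consistency

variable {Ω : Type*} [MeasurableSpace Ω] {μ : Measure Ω} [IsProbabilityMeasure μ] {h₀ : ℝ → ℝ}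
  {B : Set (Vec P)} {β₀ : Vec P} {Ts Cs : ℕ → Ω → EReal} {D : ℕ → Ω → Obs P}

/-- The zero of the expected partial score being unique, no direction is degenerate for the
pairwise comparisons. -/
lemma RegularityConditions.not_ae_inner_eq_zero (hM : CoxModel μ h₀ β₀ Ts Cs D)
    (hR : RegularityConditions μ B β₀ D) {β : Vec P} (hβ : β ∈ B) (hne : β ≠ β₀) :
    ¬ ∀ᵐ z ∂((μ.map (D 0)).prod (μ.map (D 0))), z ∈ eventPairs P →
      inner ℝ (Obs.cov z.1 - Obs.cov z.2) (β - β₀) = 0 := by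
  intro hae
  obtain ⟨n, hn0, hn1⟩ := (hR.score_zero.and hR.score_ne_zero).exists
  refine hn1 β hβ hne (Eq.trans (integral_congr_ae ?_) hn0)
  have hall : ∀ᵐ ω ∂μ, ∀ i j, i ≠ j → (D i ω, D j ω) ∈ eventPairs P →
      inner ℝ (Obs.cov (D i ω) - Obs.cov (D j ω)) (β - β₀) = 0 := by
    refine ae_all_iff.2 fun i => ae_all_iff.2 fun j => ?_
    by_cases hij : i = j
    · exact Eventually.of_forall fun ω h => absurd hij h
    rw [← map_pair_eq_prod hM.measurable_obs hM.indep hM.identDistrib hij] at hae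
    filter_upwards [ae_of_ae_map
      ((hM.measurable_obs i).prodMk (hM.measurable_obs j)).aemeasurable hae] with ω hω _
    exact hω
  filter_upwards [hall] with ω hω
  have h := scorePL_add_eq (n := n) (D := fun i => D i ω) (v := β - β₀) (fun i j he ht => ?_) β₀
  · rwa [add_sub_cancel] at h
  -- The product law covers only distinct indices; on the diagonal the covariate difference is zero.
  · by_cases hij : i = j
    · subst hij
      simp
    · exact hω i j hij ⟨(hM.event_eq_zero_or_one i ω).resolve_left he, ht⟩

/-- At a fixed parameter value other than the true one, the normalized log composite partial
likelihood falls short of its true-value level with probability tending to one. -/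
lemma tendsto_measure_normLogCPL_sub_ge (hM : CoxModel μ h₀ β₀ Ts Cs D)
    (hR : RegularityConditions μ B β₀ D) {β : Vec P} (hβ : β ∈ B) (hne : β ≠ β₀) :
    ∃ m : ℝ, m < 0 ∧ Tendsto (fun n : ℕ => μ {ω | m ≤
      normLogCPL n (fun i => D i ω) β - normLogCPL n (fun i => D i ω) β₀}) atTop (𝓝 0) := by
  have hneg := hM.integral_pairContrast_neg 0 β (hR.not_ae_inner_eq_zero hM hβ hne)
  set m := ∫ z, (eventPairs P).indicator (pairContrast β₀ β) z
    ∂((μ.map (D 0)).prod (μ.map (D 0))) with hm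
  refine ⟨m, hneg, ?_⟩
  -- The level is `m / 2` because `normLogCPL` divides by `n(n-1)/2` while the sum has `n(n-1)`
  -- ordered pairs. It exceeds the mean `m` since `m < 0`.
  have hlim := tendsto_measure_sum_pairs_ge hM.measurable_obs hM.indep hM.identDistrib
    ((measurable_pairContrast β₀ β).indicator measurableSet_eventPairs)
    (hM.memLp_indicator_pairContrast 0 β) (c := m / 2) (by rw [← hm]; linarith)
  refine tendsto_of_tendsto_of_tendsto_of_le_of_le' tendsto_const_nhds hlim
    (Eventually.of_forall fun n => zero_le) ?_
  filter_upwards [eventually_ge_atTop 2] with n hn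
  refine measure_mono fun ω hω => ?_
  have h1 : m ≤ normLogCPL n (fun i => D i ω) β - normLogCPL n (fun i => D i ω) β₀ := hω
  have h2 := logCPL_sub_le n (D := fun i => D i ω) (fun i => hM.event_eq_zero_or_one i ω) β₀ β
  refine le_trans ?_ h2
  have hn' : (2 : ℝ) ≤ n := by exact_mod_cast hn
  have hpos : (0 : ℝ) < n * (n - 1) / 2 := by
    have : (0 : ℝ) < n - 1 := by linarith
    positivity
  unfold normLogCPL at h1
  rw [Nat.cast_choose_two, ← mul_sub, inv_mul_eq_div, le_div_iff₀ hpos] at h1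
  linarith

/-- On the sphere of a ball contained in the parameter space, the normalized log composite partial
likelihood is below its true-value level with probability tending to one. -/
lemma tendsto_measure_exists_sphere_ge (hM : CoxModel μ h₀ β₀ Ts Cs D)
    (hR : RegularityConditions μ B β₀ D) {r : ℝ} (hr : 0 < r)
    (hrB : Metric.closedBall β₀ r ⊆ B) :
    Tendsto (fun n : ℕ => μ {ω | ∃ β ∈ Metric.sphere β₀ r,
      normLogCPL n (fun i => D i ω) β₀ ≤ normLogCPL n (fun i => D i ω) β}) atTop (𝓝 0) := by
  have hSB : Metric.sphere β₀ r ⊆ B := Metric.sphere_subset_closedBall.trans hrB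
  have hSne : ∀ β ∈ Metric.sphere β₀ r, β ≠ β₀ := fun β hβ => Metric.ne_of_mem_sphere hβ hr.ne'
  have hex : ∀ β : Vec P, ∃ m : ℝ, m < 0 ∧ (β ∈ Metric.sphere β₀ r →
      Tendsto (fun n : ℕ => μ {ω | m ≤
        normLogCPL n (fun i => D i ω) β - normLogCPL n (fun i => D i ω) β₀}) atTop (𝓝 0)) := by
    intro β
    by_cases hβ : β ∈ Metric.sphere β₀ r
    · obtain ⟨m, hm, h⟩ := tendsto_measure_normLogCPL_sub_ge hM hR (hSB hβ) (hSne β hβ)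
      exact ⟨m, hm, fun _ => h⟩
    · exact ⟨-1, by norm_num, fun h => absurd h hβ⟩
  choose m hm hlim using hex
  refine ENNReal.tendsto_nhds_zero.2 fun δ hδ => ?_
  obtain ⟨M, hMev⟩ := hR.bounded_CPL 1 (by simp) (δ / 2) (ENNReal.half_pos hδ.ne')
  set L := max M 1 with hL
  have hL0 : 0 < L := lt_of_lt_of_le one_pos (le_max_right _ _)
  -- With Lipschitz constant `L`, the likelihood varies by less than `-m β` from the centre `β`
  -- across its ball, too little to make up the deficit there.
  obtain ⟨t, htS, htcov⟩ := (isCompact_sphere β₀ r).elim_nhds_subcover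
    (fun β => Metric.ball β (-m β / L))
    fun β _ => Metric.ball_mem_nhds β (div_pos (neg_pos.2 (hm β)) hL0)
  have hsum : Tendsto (fun n : ℕ => ∑ β ∈ t, μ {ω | m β ≤
      normLogCPL n (fun i => D i ω) β - normLogCPL n (fun i => D i ω) β₀}) atTop (𝓝 0) := by
    simpa using tendsto_finsetSum t fun β hβ => hlim β (htS β hβ)
  filter_upwards [hMev, ENNReal.tendsto_nhds_zero.1 hsum (δ / 2) (ENNReal.half_pos hδ.ne')]
    with n hn1 hn2
  have hsub : {ω | ∃ β ∈ Metric.sphere β₀ r,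
      normLogCPL n (fun i => D i ω) β₀ ≤ normLogCPL n (fun i => D i ω) β} ≤ᵐ[μ]
      ({ω | ∃ β ∈ B, M < ‖iteratedFDeriv ℝ 1 (normLogCPL n (fun i => D i ω)) β‖} ∪
        ⋃ β ∈ t, {ω | m β ≤
          normLogCPL n (fun i => D i ω) β - normLogCPL n (fun i => D i ω) β₀} : Set Ω) := by
    filter_upwards [hR.contDiff_CPL n] with ω hω
    rintro ⟨β, hβS, hβ⟩
    by_contra hnot
    have hnot' := not_or.1 hnot
    have hder : ∀ x ∈ B, ‖fderiv ℝ (normLogCPL n (fun i => D i ω)) x‖ ≤ L := by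
      intro x hx
      rw [← norm_iteratedFDeriv_one]
      exact (not_lt.1 fun h => hnot'.1 ⟨x, hx, h⟩).trans (le_max_left _ _)
    obtain ⟨γ, hγt, hγ⟩ := Set.mem_iUnion₂.1 (htcov hβS)
    -- The mean value inequality needs a convex domain, which the closed ball provides and `B` need
    -- not.
    have hlip := (convex_closedBall β₀ r).norm_image_sub_le_of_norm_fderiv_le
      (f := normLogCPL n (fun i => D i ω))
      (fun x hx => (hω x (hrB hx)).differentiableAt (by norm_num)) (fun x hx => hder x (hrB hx))
      (Metric.sphere_subset_closedBall (htS γ hγt)) (Metric.sphere_subset_closedBall hβS)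
    have h1 : normLogCPL n (fun i => D i ω) γ - normLogCPL n (fun i => D i ω) β₀ < m γ :=
      not_le.1 fun h => hnot'.2 (Set.mem_iUnion₂.2 ⟨γ, hγt, h⟩)
    have h2 : L * ‖β - γ‖ < -m γ := by
      rw [Metric.mem_ball, dist_eq_norm, lt_div_iff₀ hL0] at hγ
      linarith
    have h3 := (le_abs_self _).trans (Real.norm_eq_abs _ ▸ hlip)
    linarith
  calc μ _ ≤ _ := measure_mono_ae hsub
    _ ≤ _ := measure_union_le _ _
    _ ≤ δ / 2 + δ / 2 := add_le_add hn1 ((measure_biUnion_finset_le _ _).trans hn2)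
    _ = δ := ENNReal.add_halves δ

end Consistency

end CoxCPL

/-! ### Existence and consistency of the estimator -/

theorem proposition2 {Ω : Type*} [MeasurableSpace Ω] (μ : Measure Ω) [IsProbabilityMeasure μ]
    {P : ℕ} (B : Set (CoxCPL.Vec P)) (β₀ : CoxCPL.Vec P) (h₀ : ℝ → ℝ)
    (Ts Cs : ℕ → Ω → EReal) (D : ℕ → Ω → CoxCPL.Obs P)
    (hmodel : CoxCPL.CoxModel μ h₀ β₀ Ts Cs D)
    (hreg : CoxCPL.RegularityConditions μ B β₀ D) :
    (∀ n ω, ∃ b, CoxCPL.IsMaxCPLEstimate B n (fun i => D i ω) b) ∧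
    ∀ βhat : ℕ → Ω → CoxCPL.Vec P,
      (∀ n, ∀ᵐ ω ∂μ, CoxCPL.IsMaxCPLEstimate B n (fun i => D i ω) (βhat n ω)) →
      TendstoInMeasure μ βhat atTop (fun _ => β₀) := by
  have hβ₀ : β₀ ∈ B := interior_subset hreg.interior
  refine ⟨fun n ω => CoxCPL.exists_isMaxCPLEstimate hreg.compact ⟨β₀, hβ₀⟩ n _,
    fun βhat hmax => ?_⟩
  rw [tendstoInMeasure_iff_dist]
  intro ε hε
  obtain ⟨r₀, hr₀, hr₀B⟩ := Metric.nhds_basis_closedBall.mem_iff.1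
    (mem_interior_iff_mem_nhds.1 hreg.interior)
  -- Small enough to stay in `B`, and at most `ε / 2` because concavity yields only a non-strict
  -- distance bound, to be contradicted by `ε ≤ dist`.
  have hr : 0 < min r₀ (ε / 2) := lt_min hr₀ (half_pos hε)
  refine tendsto_of_tendsto_of_tendsto_of_le_of_le' tendsto_const_nhds
    (CoxCPL.tendsto_measure_exists_sphere_ge hmodel hreg hr
      ((Metric.closedBall_subset_closedBall (min_le_left _ _)).trans hr₀B))
    (Eventually.of_forall fun n => zero_le) ?_
  filter_upwards [eventually_ge_atTop 2] with n hn
  refine measure_mono_ae ?_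
  filter_upwards [hmax n] with ω hω hdist
  have hchoose : (0 : ℝ) < ((n.choose 2 : ℕ) : ℝ)⁻¹ :=
    inv_pos.2 (Nat.cast_pos.2 (Nat.choose_pos hn))
  by_contra hnot
  have hlt : ∀ x ∈ Metric.sphere β₀ (min r₀ (ε / 2)),
      CoxCPL.logCPL n (fun i => D i ω) x < CoxCPL.logCPL n (fun i => D i ω) β₀ := fun x hx =>
    lt_of_mul_lt_mul_left (not_le.1 fun h => hnot ⟨x, hx, h⟩) hchoose.le
  have h1 := CoxCPL.dist_le_of_concaveOn (CoxCPL.concaveOn_logCPL n _) hr hlt (hω.logCPL_le hβ₀)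
  have h2 : ε ≤ dist (βhat n ω) β₀ := hdist
  linarith [min_le_right r₀ (ε / 2)]
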